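/- Setting. All objects are smooth. Let $Q$ be an $n$-dimensional manifold with a contravariant pseudo-Riemannian metric $G=(g^{ij})$ of arbitrary signature, $n=m+r$, $m\ge 1$. A Killing tensor is a symmetric contravariant 2-tensor $K$ with vanishing Schouten bracket $[K,G]$. A separable Killing algebra $(D_r,\mathcal K_m)$ consists of: (a) an $r$-dimensional Abelian algebra $D_r$ of Killing vectors spanning a distribution $\Delta$ of rank $r$ such that $\Delta\cap\Delta^\perp$ has constant rank $m_0$; (b) an $m$-dimensional space $\mathcal K_m$ of Killing tensors with $m$ common eigenvector fields $E_1,\dots,E_m$ that are linearly independent at each point, orthogonal to $D_r$, normal (orthogonally integrable) and have real eigenvalues, such that a tensor $K\in\mathcal K_m$ that annihilates all $E_a$ at some point is zero; (c) $\mathcal K_m$ is $D_r$-invariant; together with condition (d) below. Coordinates $(q^a,q^\alpha)$, $a=1,\dots,m$, $\alpha=m+1,\dots,n$, on an open subset of $Q$ are adapted to $(D_r,\mathcal K_m)$ if the hypersurfaces $q^a=\mathrm{const}$ are orthogonal to $E_a$, the fields $\partial_\alpha$ form a basis of $D_r$, the submanifolds on which all $q^\alpha$ are constant are tangent to each non-null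 $E_a$, and (d) if $m_0>1$, then $d(K\cdot dg^{\alpha\beta})=0$ for all $K\in\mathcal K_m$ and all $\alpha,\beta$. The $q^a$ are the essential coordinates; those with $g^{aa}=0$ are called isotropic. Let $K_1,\dots,K_m=G$ be a basis of $\mathcal K_m$, let $\lambda_b^a$ be the eigenvalue of $K_b$ on $E_a$, and let $\Lambda=(\lambda_b^a)$ ($b$ is the row index, $a$ the column index). Put $$f_a^{bc}=\frac{\det\Lambda_b^a}{\det\Lambda_c^a}\qquad\text{wherever }\det\Lambda_c^a\ne0,$$ where $\Lambda_b^a$ is $\Lambda$ without its $b$-th row and $a$-th column. Coordinates $(q^a,q^\alpha)$ are standard with Stäckel matrix $S=(\varphi_a^{(b)})$ (row index $a$, column index $b$) if $S$ is an everywhere invertible $m\times m$ matrix whose $a$-th row is a smooth function of $q^a$ only, $\partial_\alpha g^{ij}=0$ for all $\alpha,i,j$, and, with $S^{-1}=(\varphi^a_{(b)})$ and suitable smooth functions $\theta_a^\beta,\eta_a^{\alpha\beta}$ of $q^a$ only, for all $b=1,\dots,m$: $K_b^{ac}=0$ for $a\ne c\le m$; $K_b^{aa}=\varphi^a_{(b)}$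 and $K_b^{a\beta}=0$ if $q^a$ is not isotropic; $K_b^{aa}=0$ and $K_b^{a\beta}=\theta_a^\beta\varphi^a_{(b)}$ if $q^a$ is isotropic; and $g^{\alpha\beta}=\sum_a\eta_a^{\alpha\beta}\varphi^a_{(m)}$. In such coordinates $\partial_a$ is a Stäckel symmetry if $\partial_a\ln|\varphi^b_{(m)}|=0$ for all $b=1,\dots,m$. Theorem 4.11. Let $(q^a,q^\alpha)$ be coordinates adapted to a separable Killing algebra $(D_r,\mathcal K_m)$ and let $K_1,\dots,K_m=G$ be a basis of $\mathcal K_m$. For every $a=1,\dots,m$ exactly one of the following holds. I) On each part of the coordinate domain that is represented by an open convex set of coordinate values there is a rescaling $\breve q^a=\breve q^a(q^a)$, with nowhere vanishing derivative, such that the coordinates with $q^a$ replaced by $\breve q^a$ are standard with a Stäckel matrix that does not depend on $\breve q^a$, and $\breve\partial_a$ is a Stäckel symmetry. II) There are indices $b,c$ such that $df_a^{bc}\neq0$ at some point of the coordinate domain where $f_a^{bc}$ is defined, and every such point has a neighbourhood in which $f_a^{bc}$ is defined, $df_a^{bc}\ne0$, and the level sets $f_a^{bc}=\mathrm{const}$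 are exactly the hypersurfaces $q^a=\mathrm{const}$. -/

import Mathlib

open scoped Manifold ContDiff Topology

noncomputable section

namespace KillingSep

/-- Coordinate tuples `(q^a, q^α)`: `k + 1 = m` essential coordinates (`Sum.inl a`) and
`r` ignorable ones (`Sum.inr α`). -/
abbrev Coord (k r : ℕ) : Type := Fin (k + 1) ⊕ Fin r → ℝ

/-- The model of a boundaryless manifold of dimension `n = (k + 1) + r`. -/
abbrev Mdl (k r : ℕ) : ModelWithCorners ℝ (Coord k r) (Coord k r) :=
  modelWithCornersSelf ℝ (Coord k r)

section Tensors

variable (k r : ℕ) (Q : Type*) [TopologicalSpace Q] [ChartedSpace (Coord k r) Q]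

/-- The cotangent space of `Q` at `x`. -/
abbrev Cot (x : Q) : Type := TangentSpace (Mdl k r) x →L[ℝ] ℝ

/-- Vector fields on `Q` (no smoothness yet). -/
abbrev VF : Type _ := (x : Q) → TangentSpace (Mdl k r) x

/-- One-forms on `Q` (no smoothness yet). -/
abbrev OneForm : Type _ := (x : Q) → Cot k r Q x

/-- Contravariant two-tensor fields on `Q`, as bilinear forms on the cotangent spaces
(no smoothness or symmetry yet). -/
abbrev Tensor2 : Type _ := (x : Q) → Cot k r Q x →ₗ[ℝ] Cot k r Q x →ₗ[ℝ] ℝ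

end Tensors

/-- The partial derivative `∂_i f` at `y` of a function of the coordinates. -/
def pd {k r : ℕ} (i : Fin (k + 1) ⊕ Fin r) (f : Coord k r → ℝ) (y : Coord k r) : ℝ :=
  fderiv ℝ f y (Pi.single i 1)

section Fields

variable {k r : ℕ} {Q : Type*} [TopologicalSpace Q] [ChartedSpace (Coord k r) Q]

/-- The differential at `x` of the `i`-th coordinate of the chart `e`. -/
def dq (e : OpenPartialHomeomorph Q (Coord k r)) (i : Fin (k + 1) ⊕ Fin r) (x : Q) :
    Cot k r Q x :=
  mfderiv (Mdl k r) 𝓘(ℝ, ℝ) (fun y => e y i) x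

/-- The component `T^{ij}` of `T` in the chart `e`, as a function of the coordinates. -/
def comp (T : Tensor2 k r Q) (e : OpenPartialHomeomorph Q (Coord k r))
    (i j : Fin (k + 1) ⊕ Fin r) (y : Coord k r) : ℝ :=
  T (e.symm y) (dq e i (e.symm y)) (dq e j (e.symm y))

/-- The component `X^i` of the vector field `X` in the chart `e`. -/
def vcomp (X : VF k r Q) (e : OpenPartialHomeomorph Q (Coord k r))
    (i : Fin (k + 1) ⊕ Fin r) (y : Coord k r) : ℝ :=
  dq e i (e.symm y) (X (e.symm y))

/-- Smooth vector field: smooth components in every smooth chart. -/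
def IsSmoothVF (X : VF k r Q) : Prop :=
  ∀ e ∈ IsManifold.maximalAtlas (Mdl k r) ∞ Q, ∀ i, ContDiffOn ℝ ∞ (vcomp X e i) e.target

/-- Smooth symmetric contravariant two-tensor field. -/
structure IsSymTensor (T : Tensor2 k r Q) : Prop where
  symm : ∀ x ζ η, T x ζ η = T x η ζ
  smooth : ∀ e ∈ IsManifold.maximalAtlas (Mdl k r) ∞ Q, ∀ i j,
    ContDiffOn ℝ ∞ (comp T e i j) e.target

/-- Contravariant pseudo-Riemannian metric, of arbitrary signature. -/
structure IsMetric (G : Tensor2 k r Q) : Prop extends IsSymTensor G where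
  nondeg : ∀ x ζ, (∀ η, G x ζ η = 0) → ζ = 0

/-- `ℒ_X T = 0`:  `X^l ∂_l T^{ij} - T^{lj} ∂_l X^i - T^{il} ∂_l X^j = 0` in all charts. -/
def LieInvariant (X : VF k r Q) (T : Tensor2 k r Q) : Prop :=
  ∀ e ∈ IsManifold.maximalAtlas (Mdl k r) ∞ Q, ∀ y ∈ e.target, ∀ i j,
    ∑ l, (vcomp X e l y * pd l (comp T e i j) y
      - comp T e l j y * pd l (vcomp X e i) y
      - comp T e i l y * pd l (vcomp X e j) y) = 0

/-- `K` is a Killing tensor of `G`: it is a smooth symmetric tensor whose Lie-Schouten bracket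
`[K, G]` (i.e. the Poisson bracket of `K^{ij} p_i p_j` and `g^{ij} p_i p_j`) vanishes. -/
structure IsKillingTensor (G K : Tensor2 k r Q) : Prop extends IsSymTensor K where
  bracket : ∀ e ∈ IsManifold.maximalAtlas (Mdl k r) ∞ Q, ∀ y ∈ e.target, ∀ i j h,
    ∑ l, (comp K e l i y * pd l (comp G e j h) y
        + comp K e l j y * pd l (comp G e h i) y
        + comp K e l h y * pd l (comp G e i j) y
        - comp G e l i y * pd l (comp K e j h) y
        - comp G e l j y * pd l (comp K e h i) y
        - comp G e l h y * pd l (comp K e i j) y) = 0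

/-- The distribution `Δ` spanned by a space `D` of vector fields. -/
def dist (D : Submodule ℝ (VF k r Q)) (x : Q) : Submodule ℝ (TangentSpace (Mdl k r) x) :=
  D.map (LinearMap.proj x)

/-- `Δ^⊥`: the vectors `v` whose metric dual one-form `ζ` annihilates `Δ`. -/
def distPerp (G : Tensor2 k r Q) (D : Submodule ℝ (VF k r Q)) (x : Q) :
    Submodule ℝ (TangentSpace (Mdl k r) x) where
  carrier := {v | ∃ ζ : Cot k r Q x, (∀ η, G x ζ η = η v) ∧ ∀ X ∈ D, ζ (X x) = 0}
  zero_mem' := ⟨0, by simp, by simp⟩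
  add_mem' := by
    rintro v w ⟨ζ, h1, h2⟩ ⟨ζ', h1', h2'⟩
    refine ⟨ζ + ζ', fun η => ?_, fun X hX => ?_⟩
    · simp [h1 η, h1' η]
    · simp [h2 X hX, h2' X hX]
  smul_mem' := by
    rintro c v ⟨ζ, h1, h2⟩
    refine ⟨c • ζ, fun η => ?_, fun X hX => ?_⟩
    · simp [h1 η]
    · simp [h2 X hX]

/-- The vector field metrically dual to the one-form `ξ` is normal (orthogonally integrable):
locally, `ξ` is proportional to the differential of a smooth function without critical points. -/
def IsNormal (ξ : OneForm k r Q) : Prop :=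
  ∀ x, ∃ U ∈ 𝓝 x, ∃ f : Q → ℝ, ContMDiffOn (Mdl k r) 𝓘(ℝ, ℝ) ∞ f U ∧
    ∀ y ∈ U, mfderiv (Mdl k r) 𝓘(ℝ, ℝ) f y ≠ 0 ∧
      ∃ c : ℝ, (mfderiv (Mdl k r) 𝓘(ℝ, ℝ) f y : Cot k r Q y) = c • ξ y

/-- `(D, 𝒦)` is a separable Killing algebra of the metric `G`, with common eigenvectors `E_a`,
`a = 1, …, m = k + 1`.  The eigenvectors are recorded through their dual one-forms
`ξ_a = G^♭ E_a`, so that `K E_a = λ E_a` reads `K(ξ_a, ·) = λ G(ξ_a, ·)`, and `E_a ⊥ X` reads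
`ξ_a(X) = 0`. The number `m₀` is the rank of `Δ ∩ Δ^⊥`.
(The condition that concerns the functions `g^{αβ}` for `m₀ > 1` involves the ignorable
coordinates and is in `IsAdapted`.) -/
structure IsSeparableKillingAlgebra (G : Tensor2 k r Q)
    (D : Submodule ℝ (VF k r Q)) (𝒦 : Submodule ℝ (Tensor2 k r Q))
    (ξ : Fin (k + 1) → OneForm k r Q) (m₀ : ℕ) : Prop where
  /-- `D` consists of (smooth) Killing vectors. -/
  smooth_D : ∀ X ∈ D, IsSmoothVF X
  killing_D : ∀ X ∈ D, LieInvariant X G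
  /-- `D` is Abelian and of dimension `r`. -/
  abelian_D : ∀ X ∈ D, ∀ Y ∈ D, VectorField.mlieBracket (Mdl k r) X Y = 0
  finite_D : Module.Finite ℝ D
  finrank_D : Module.finrank ℝ D = r
  /-- `D` spans a regular distribution `Δ` of rank `r`. -/
  rank_dist : ∀ x, Module.finrank ℝ (dist D x) = r
  /-- `Δ ∩ Δ^⊥` has constant rank. -/
  rank_null : ∀ x, Module.finrank ℝ ↥(dist D x ⊓ distPerp G D x) = m₀
  /-- `𝒦` is an `m`-dimensional space of Killing tensors. -/
  killing_𝒦 : ∀ K ∈ 𝒦, IsKillingTensor G K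
  finite_𝒦 : Module.Finite ℝ 𝒦
  finrank_𝒦 : Module.finrank ℝ 𝒦 = k + 1
  /-- The `m` eigenvectors are independent, orthogonal to `D`, and normal. -/
  indep_ξ : ∀ x, LinearIndependent ℝ (fun a => ξ a x)
  orth_ξ : ∀ a x, ∀ X ∈ D, ξ a x (X x) = 0
  normal_ξ : ∀ a, IsNormal (ξ a)
  /-- They are eigenvectors of every `K ∈ 𝒦`, with real eigenvalues. -/
  eigen : ∀ K ∈ 𝒦, ∀ a x, ∃ c : ℝ, ∀ η, K x (ξ a x) η = c * G x (ξ a x) η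
  /-- The elements of `𝒦` are (pointwise) independent as operators on the span of the common
  eigenvectors. -/
  indep_𝒦 : ∀ K ∈ 𝒦, ∀ x, (∀ a η, K x (ξ a x) η = 0) → K = 0
  /-- `𝒦` is `D`-invariant. -/
  invariant : ∀ X ∈ D, ∀ K ∈ 𝒦, LieInvariant X K

/-- The one-form `K · dF`, where `K` acts on one-forms by means of the metric:
`(K · dF)_i = g_{ij} K^{jh} ∂_h F`. -/
def tensorD (G K : Tensor2 k r Q) (e : OpenPartialHomeomorph Q (Coord k r))
    (F : Coord k r → ℝ) (i : Fin (k + 1) ⊕ Fin r) (y : Coord k r) : ℝ :=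
  ((Matrix.of fun s t => comp G e s t y)⁻¹ * (Matrix.of fun s t => comp K e s t y)).mulVec
    (fun h => pd h F y) i

/-- The chart `e` is a system of coordinates `(q^a, q^α)` adapted to `(D, 𝒦)`. -/
structure IsAdapted (G : Tensor2 k r Q)
    (D : Submodule ℝ (VF k r Q)) (𝒦 : Submodule ℝ (Tensor2 k r Q))
    (ξ : Fin (k + 1) → OneForm k r Q) (m₀ : ℕ)
    (e : OpenPartialHomeomorph Q (Coord k r)) : Prop where
  mem_atlas : e ∈ IsManifold.maximalAtlas (Mdl k r) ∞ Q
  /-- The hypersurfaces `q^a = const` are orthogonal to `E_a`. -/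
  essential : ∀ a, ∀ x ∈ e.source, ∃ c : ℝ, dq e (Sum.inl a) x = c • ξ a x
  /-- The coordinate vector fields `∂_α` form a basis of `D`. -/
  ignorable : ∃ X : Module.Basis (Fin r) ℝ D, ∀ α, ∀ x ∈ e.source, ∀ i,
    dq e i x ((X α : VF k r Q) x) = if i = Sum.inr α then 1 else 0
  /-- Choice of the origin of the parameters `q^α`: the submanifolds on which all `q^α` are
  constant are tangent to every `E_a` that is not a null vector. -/
  origin : ∀ a α, ∀ x ∈ e.source, G x (ξ a x) (ξ a x) ≠ 0 →
    G x (dq e (Sum.inl a) x) (dq e (Sum.inr α) x) = 0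
  /-- For `m₀ > 1`, `d(K · dg^{αβ}) = 0`. -/
  closed : 1 < m₀ → ∀ K ∈ 𝒦, ∀ α β, ∀ y ∈ e.target, ∀ i j,
    pd i (tensorD G K e (comp G e (Sum.inr α) (Sum.inr β)) j) y
      = pd j (tensorD G K e (comp G e (Sum.inr α) (Sum.inr β)) i) y

/-- `Λ = (λ_i^b)`, where `λ_i^b` is the eigenvalue of `K_i` associated with `E_b`
(row index `i`, column index `b`). -/
def IsEigenvalueMatrix (G : Tensor2 k r Q) (K : Fin (k + 1) → Tensor2 k r Q)
    (ξ : Fin (k + 1) → OneForm k r Q)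
    (Λ : Q → Matrix (Fin (k + 1)) (Fin (k + 1)) ℝ) : Prop :=
  ∀ x i b η, K i x (ξ b x) η = Λ x i b * G x (ξ b x) η

/-- `det Λ_b^a`: the `b`-th row and the `a`-th column are eliminated. -/
def minor (A : Matrix (Fin (k + 1)) (Fin (k + 1)) ℝ) (b a : Fin (k + 1)) : ℝ :=
  (A.submatrix b.succAbove a.succAbove).det

/-- The fundamental function `f_a^{bc} = det Λ_b^a / det Λ_c^a`, meaningful where
`det Λ_c^a ≠ 0`. -/
def fund (Λ : Q → Matrix (Fin (k + 1)) (Fin (k + 1)) ℝ) (a b c : Fin (k + 1)) (x : Q) : ℝ :=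
  minor (Λ x) b a / minor (Λ x) c a

/-- The matrix `(φ_a^{(b)}(q^a))` (row index `a`, column index `b`) at the coordinates `y`. -/
def stackelMatrix (S : Fin (k + 1) → Fin (k + 1) → ℝ → ℝ) (y : Coord k r) :
    Matrix (Fin (k + 1)) (Fin (k + 1)) ℝ :=
  Matrix.of fun a b => S a b (y (Sum.inl a))

/-- The entry `φ^a_{(b)}` of the inverse of the Stäckel matrix. -/
def phi (S : Fin (k + 1) → Fin (k + 1) → ℝ → ℝ) (b a : Fin (k + 1)) (y : Coord k r) : ℝ :=
  (stackelMatrix S y)⁻¹ b a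

/-- The coordinates of the chart `e` are standard separable coordinates: `S = (φ_a^{(b)})` is a
Stäckel matrix from which the metric `G`, and the components along the essential coordinates of
the basis `K_1, …, K_m = G`, are obtained in the standard form; `null` is the set of indices of
the isotropic coordinates. -/
structure IsStandard (G : Tensor2 k r Q) (K : Fin (k + 1) → Tensor2 k r Q)
    (e : OpenPartialHomeomorph Q (Coord k r)) (null : Set (Fin (k + 1)))
    (S : Fin (k + 1) → Fin (k + 1) → ℝ → ℝ) (θ : Fin (k + 1) → Fin r → ℝ → ℝ)
    (η : Fin (k + 1) → Fin r → Fin r → ℝ → ℝ) : Prop where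
  smooth_S : ∀ a b, ContDiffOn ℝ ∞ (S a b) ((fun y => y (Sum.inl a)) '' e.target)
  smooth_θ : ∀ a β, ContDiffOn ℝ ∞ (θ a β) ((fun y => y (Sum.inl a)) '' e.target)
  smooth_η : ∀ a α β, ContDiffOn ℝ ∞ (η a α β) ((fun y => y (Sum.inl a)) '' e.target)
  regular : ∀ y ∈ e.target, (stackelMatrix S y).det ≠ 0
  ignorable : ∀ y ∈ e.target, ∀ α i j, pd (Sum.inr α) (comp G e i j) y = 0
  /-- `K_b^{ac} = 0` for essential `a ≠ c` (including `g^{ac} = 0`). -/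
  offdiag : ∀ y ∈ e.target, ∀ b a c, a ≠ c → comp (K b) e (Sum.inl a) (Sum.inl c) y = 0
  /-- `K_b^{aa} = φ^a_{(b)}`, `K_b^{aβ} = 0` for non-isotropic `q^a`. -/
  diag : ∀ y ∈ e.target, ∀ b, ∀ a ∉ null,
    comp (K b) e (Sum.inl a) (Sum.inl a) y = phi S b a y ∧
      ∀ β, comp (K b) e (Sum.inl a) (Sum.inr β) y = 0
  /-- `K_b^{aa} = 0`, `K_b^{aβ} = θ_a^β φ^a_{(b)}` for isotropic `q^a`. -/
  isotropic : ∀ y ∈ e.target, ∀ b, ∀ a ∈ null,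
    comp (K b) e (Sum.inl a) (Sum.inl a) y = 0 ∧
      ∀ β, comp (K b) e (Sum.inl a) (Sum.inr β) y = θ a β (y (Sum.inl a)) * phi S b a y
  /-- `g^{αβ} = ∑_a η_a^{αβ} φ^a_{(m)}`. -/
  ignorable_block : ∀ y ∈ e.target, ∀ α β,
    comp G e (Sum.inr α) (Sum.inr β) y
      = ∑ a, η a α β (y (Sum.inl a)) * phi S (Fin.last k) a y

/-- `∂_a` is a conformal Stäckel symmetry with factor `F`: `∂_a ln φ^b_{(m)} = F` for all `b`
(`Real.log` is `ln |·|`). -/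
def IsCSSymmetry (S : Fin (k + 1) → Fin (k + 1) → ℝ → ℝ)
    (e : OpenPartialHomeomorph Q (Coord k r)) (a : Fin (k + 1)) (F : Coord k r → ℝ) : Prop :=
  ∀ y ∈ e.target, ∀ b, pd (Sum.inl a) (fun z => Real.log (phi S (Fin.last k) b z)) y = F y

/-- `∂_a` is a Stäckel symmetry. -/
def IsStackelSymmetry (S : Fin (k + 1) → Fin (k + 1) → ℝ → ℝ)
    (e : OpenPartialHomeomorph Q (Coord k r)) (a : Fin (k + 1)) : Prop :=
  IsCSSymmetry S e a (fun _ => 0)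

/-- The Stäckel matrix does not depend on `q^a`. -/
def IndependentOf (S : Fin (k + 1) → Fin (k + 1) → ℝ → ℝ)
    (e : OpenPartialHomeomorph Q (Coord k r)) (a : Fin (k + 1)) : Prop :=
  ∀ y ∈ e.target, ∀ z ∈ e.target, (∀ i, i ≠ Sum.inl a → y i = z i) →
    stackelMatrix S y = stackelMatrix S z

/-- The chart `e'` is the restriction of `e` to the points with coordinates in `V`, with `q^a`
replaced by `ψ(q^a)`, where `ψ' ≠ 0`. -/
structure IsRescaling (e e' : OpenPartialHomeomorph Q (Coord k r)) (V : Set (Coord k r))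
    (a : Fin (k + 1)) (ψ : ℝ → ℝ) : Prop where
  smooth : ContDiffOn ℝ ∞ ψ ((fun y => y (Sum.inl a)) '' V)
  regular : ∀ y ∈ V, deriv ψ (y (Sum.inl a)) ≠ 0
  source : e'.source = e.source ∩ e ⁻¹' V
  coord : ∀ x ∈ e'.source, e' x = Function.update (e x) (Sum.inl a) (ψ (e x (Sum.inl a)))

/-- On every open convex (in coordinates) part of the domain of `e` there is a rescaling of `q^a`
after which `∂_a` is a Stäckel symmetry and the Stäckel matrix does not depend on `q^a`. -/
def SymmetryAfterRescaling (G : Tensor2 k r Q)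
    (K : Fin (k + 1) → Tensor2 k r Q)
    (e : OpenPartialHomeomorph Q (Coord k r)) (a : Fin (k + 1)) : Prop :=
  ∀ V ⊆ e.target, IsOpen V → Convex ℝ V →
    ∃ e' ∈ IsManifold.maximalAtlas (Mdl k r) ∞ Q, ∃ ψ : ℝ → ℝ, IsRescaling e e' V a ψ ∧
      ∃ null S θ η, IsStandard G K e' null S θ η ∧ IsStackelSymmetry S e' a ∧
        IndependentOf S e' a

/-- `f_a^{bc}` is defined and has nonzero differential at `x`. -/
def IsRegularPoint (Λ : Q → Matrix (Fin (k + 1)) (Fin (k + 1)) ℝ) (a b c : Fin (k + 1))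
    (x : Q) : Prop :=
  minor (Λ x) c a ≠ 0 ∧ mfderiv (Mdl k r) 𝓘(ℝ, ℝ) (fund Λ a b c) x ≠ 0

/-- For some `b`, `c`, the function `f_a^{bc}` has points with nonzero differential, and near each
of them its level sets are the hypersurfaces of the foliation `q^a = const`. -/
def LevelSetsDefineFoliation (Λ : Q → Matrix (Fin (k + 1)) (Fin (k + 1)) ℝ)
    (e : OpenPartialHomeomorph Q (Coord k r)) (a : Fin (k + 1)) : Prop :=
  ∃ b c, (∃ x ∈ e.source, IsRegularPoint (r := r) Λ a b c x) ∧
    ∀ x ∈ e.source, IsRegularPoint (r := r) Λ a b c x →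
      ∃ W, IsOpen W ∧ x ∈ W ∧ W ⊆ e.source ∧ (∀ y ∈ W, IsRegularPoint (r := r) Λ a b c y) ∧
        ∀ y ∈ W, ∀ z ∈ W, fund Λ a b c y = fund Λ a b c z ↔ e y (Sum.inl a) = e z (Sum.inl a)

end Fields

end KillingSep

end

/-! On a convex set of values of adapted coordinates, let σ_a be g^{aa} if q^a is not isotropic, and
the Euclidean norm of the row (g^{aβ}) if it is. Put P = (λ_b^a σ_a) and S = P⁻¹. The heart of the
matter is that the a-th row of S depends on q^a alone, so that S is a Stäckel matrix
(`CoordAlgebra.pd_invMatrix`, `CoordAlgebra.exists_stackel`). Since Λ⁻¹ = diag(σ) S, Cramer's rule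
gives det Λ_b^a = ± det Λ · σ_a · S_ab. Hence f_a^{bc} = ± S_ab / S_ac is a function of q^a only
(`minor_eq_of_inv`, `fund_eq_div`).

If one of these ratios has nonzero derivative somewhere, it is locally injective there by Rolle's
theorem, and its level sets are q^a = const. If none has, the a-th row is n(q^a) v with n > 0 and v
constant. The rescaling with derivative √n then turns the row into v, and S no longer depends on the
new coordinate. Conversely, a Stäckel matrix independent of q^a makes every f_a^{bc} locally
constant, so the alternatives exclude each other.

The Stäckel property comes from the Killing equations. With K_b^{ej} = λ_b^e g^{ej} the bracket
becomes a cyclic sum of g^{ei} T_e^{jh}, where T_e = λ_b^e ∂_e G − ∂_e K_b. Linear algebra at a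
point shows that the components of T with an essential index vanish (`killing_components_eq_zero`),
which determines the derivatives of P. With at most one isotropic coordinate the ignorable block of
T vanishes too, so K_b^{αβ} is a potential of K_b · dg^{αβ}. With more of them this can fail, and
condition (d) supplies a potential instead; these potentials produce the functions η. -/

noncomputable section

namespace KillingSep

/-! ### Functions of one coordinate and primitives of closed forms on convex sets -/

section Calculus

variable {k r : ℕ} {V : Set (Coord k r)} {f g : Coord k r → ℝ} {y : Coord k r}
  {i : Fin (k + 1) ⊕ Fin r}

theorem differentiableAt_of_smoothOn (hV : IsOpen V) (hf : ContDiffOn ℝ ∞ f V) (hy : y ∈ V) :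
    DifferentiableAt ℝ f y :=
  (hf.contDiffAt (hV.mem_nhds hy)).differentiableAt (by simp)

theorem pd_congr (hV : IsOpen V) (h : ∀ z ∈ V, f z = g z) (hy : y ∈ V) : pd i f y = pd i g y := by
  have : f =ᶠ[𝓝 y] g := Filter.eventuallyEq_of_mem (hV.mem_nhds hy) h
  simp [pd, this.fderiv_eq]

theorem pd_eq_zero_of_eq_const (hV : IsOpen V) {c : ℝ} (h : ∀ z ∈ V, f z = c) (hy : y ∈ V) :
    pd i f y = 0 := by
  rw [pd_congr hV (g := fun _ => c) h hy]
  simp [pd]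

theorem pd_mul (hf : DifferentiableAt ℝ f y) (hg : DifferentiableAt ℝ g y) :
    pd i (fun z => f z * g z) y = pd i f y * g y + f y * pd i g y := by
  simp only [pd]
  rw [fderiv_fun_mul hf hg]
  simp
  ring

theorem pd_sum {ι : Type*} (s : Finset ι) {F : ι → Coord k r → ℝ}
    (hF : ∀ j ∈ s, DifferentiableAt ℝ (F j) y) :
    pd i (fun z => ∑ j ∈ s, F j z) y = ∑ j ∈ s, pd i (F j) y := by
  simp only [pd]
  rw [fderiv_fun_sum hF]
  simp

theorem fderiv_eq_sum_pd (f : Coord k r → ℝ) (y v : Coord k r) :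
    fderiv ℝ f y v = ∑ i, v i * pd i f y := by
  have hv : v = ∑ i, v i • (Pi.single i (1 : ℝ) : Coord k r) := by
    funext j
    simp [Finset.sum_apply, Pi.single_apply]
  conv_lhs => rw [hv]
  simp only [map_sum, map_smul, smul_eq_mul, pd]

theorem pd_of_hasFDerivAt {L : Coord k r →L[ℝ] ℝ} (h : HasFDerivAt f L y) :
    pd i f y = L (Pi.single i 1) := by
  simp [pd, h.fderiv]

theorem smoothOn_pd (hV : IsOpen V) (hf : ContDiffOn ℝ ∞ f V) : ContDiffOn ℝ ∞ (pd i f) V := by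
  have h : ContDiffOn ℝ ∞ (fderiv ℝ f) V :=
    ((contDiffOn_infty_iff_fderiv_of_isOpen hV).1 hf).2
  exact h.clm_apply contDiffOn_const

/-- By the mean value theorem the increment is a sum of (z − y)_j ∂_j f at a point of the segment,
and its term j = i vanishes because `y i = z i`. -/
theorem eq_of_pd_eq_zero (hV : IsOpen V) (hc : Convex ℝ V) (hf : ContDiffOn ℝ ∞ f V)
    (h : ∀ j, j ≠ i → ∀ z ∈ V, pd j f z = 0) {z : Coord k r} (hy : y ∈ V) (hz : z ∈ V)
    (hyz : y i = z i) : f y = f z := by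
  obtain ⟨w, hw, h1⟩ := domain_mvt (f := f) (s := V) (x := y) (y := z) (f' := fderiv ℝ f)
    (fun x hx => (differentiableAt_of_smoothOn hV hf hx).hasFDerivAt.hasFDerivWithinAt) hc hy hz
  have hwV : w ∈ V := hc.segment_subset hy hz hw
  rw [fderiv_eq_sum_pd, Finset.sum_eq_zero] at h1
  · linarith
  · intro j _
    by_cases hj : j = i
    · subst hj
      simp [hyz]
    · rw [h j hj w hwV, mul_zero]

/-- Convexity makes the value independent of the chosen point over `t`. Smoothness is checked by
restricting `f` to the line through a point in the direction i. -/
theorem exists_eq_comp_eval (hV : IsOpen V) (hc : Convex ℝ V) (hf : ContDiffOn ℝ ∞ f V)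
    (h : ∀ j, j ≠ i → ∀ z ∈ V, pd j f z = 0) :
    ∃ s : ℝ → ℝ, ContDiffOn ℝ ∞ s ((fun y : Coord k r => y i) '' V) ∧ ∀ y ∈ V, f y = s (y i) := by
  classical
  let s : ℝ → ℝ := fun t => if ht : ∃ y ∈ V, y i = t then f ht.choose else 0
  have hs : ∀ y ∈ V, f y = s (y i) := by
    intro y hy
    have ht : ∃ z ∈ V, z i = y i := ⟨y, hy, rfl⟩
    simp only [s, dif_pos ht]
    exact eq_of_pd_eq_zero hV hc hf h hy ht.choose_spec.1 ht.choose_spec.2.symm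
  refine ⟨s, ?_, hs⟩
  rintro _ ⟨y, hy, rfl⟩
  have hup : ContDiff ℝ ∞ (fun t : ℝ => Function.update y i t) := by
    rw [contDiff_pi]
    intro j
    by_cases hj : j = i
    · subst hj
      simpa using contDiff_fun_id
    · simpa [Function.update_of_ne hj] using contDiff_const
  have hyy : Function.update y i (y i) = y := Function.update_eq_self _ _
  have hnear : ∀ᶠ t in 𝓝 (y i), Function.update y i t ∈ V := by
    apply hup.continuous.continuousAt.preimage_mem_nhds
    rw [hyy]
    exact hV.mem_nhds hy
  have h1 : ContDiffAt ℝ ∞ (fun t => f (Function.update y i t)) (y i) := by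
    apply ContDiffAt.comp (y i) _ hup.contDiffAt
    rw [hyy]
    exact hf.contDiffAt (hV.mem_nhds hy)
  refine (h1.congr_of_eventuallyEq ?_).contDiffWithinAt
  filter_upwards [hnear] with t ht
  rw [hs _ ht]
  simp

/-- The Poincaré lemma for the form Σ om_i dy_i, whose derivative is symmetric by `hcl`. -/
theorem exists_primitive (hV : IsOpen V) (hc : Convex ℝ V)
    {om : Fin (k + 1) ⊕ Fin r → Coord k r → ℝ} (hom : ∀ i, ContDiffOn ℝ ∞ (om i) V)
    (hcl : ∀ y ∈ V, ∀ i j, pd i (om j) y = pd j (om i) y) :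
    ∃ W : Coord k r → ℝ, ContDiffOn ℝ ∞ W V ∧ ∀ y ∈ V, ∀ i, pd i W y = om i y := by
  let Ω : Coord k r → (Coord k r →L[ℝ] ℝ) := fun y =>
    ∑ i, om i y • (ContinuousLinearMap.proj i : Coord k r →L[ℝ] ℝ)
  have hΩ : ContDiffOn ℝ ∞ Ω V := by
    apply ContDiffOn.sum
    intro i _
    exact (hom i).smul contDiffOn_const
  have hval : ∀ y i, Ω y (Pi.single i 1) = om i y := by
    intro y i
    simp [Ω, Pi.single_apply, -Fintype.sum_sum_type]
  have hd : ∀ y ∈ V, ∀ v w, fderiv ℝ Ω y v w = ∑ i, ∑ j, v i * w j * pd i (om j) y := by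
    intro y hy v w
    have h1 : HasFDerivAt Ω (∑ j, (fderiv ℝ (om j) y).smulRight
        (ContinuousLinearMap.proj j : Coord k r →L[ℝ] ℝ)) y := by
      apply HasFDerivAt.fun_sum
      intro j _
      exact (differentiableAt_of_smoothOn hV (hom j) hy).hasFDerivAt.smul_const
        (ContinuousLinearMap.proj j : Coord k r →L[ℝ] ℝ)
    rw [h1.fderiv, Finset.sum_comm]
    simp only [_root_.sum_apply, ContinuousLinearMap.smulRight_apply,
      _root_.smul_apply, ContinuousLinearMap.proj_apply, smul_eq_mul]
    refine Finset.sum_congr rfl fun j _ => ?_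
    rw [fderiv_eq_sum_pd, Finset.sum_mul]
    exact Finset.sum_congr rfl fun i _ => by ring
  obtain ⟨W, hW⟩ := hc.exists_forall_hasFDerivAt_of_fderiv_symmetric hV
    (hΩ.differentiableOn (by simp)) (by
      intro y hy v w
      rw [hd y hy, hd y hy, Finset.sum_comm]
      refine Finset.sum_congr rfl fun i _ => Finset.sum_congr rfl fun j _ => ?_
      rw [hcl y hy j i]
      ring)
  refine ⟨W, ?_, fun y hy i => ?_⟩
  · rw [contDiffOn_infty_iff_fderiv_of_isOpen hV]
    refine ⟨fun y hy => (hW y hy).differentiableAt.differentiableWithinAt, ?_⟩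
    exact hΩ.congr fun y hy => (hW y hy).fderiv
  · rw [pd_of_hasFDerivAt (hW y hy), hval]

end Calculus

/-! ### Linear algebra of the Killing equation at a point -/

section KillingEquation

open Matrix

variable {A B : Type*} [Fintype A] [Fintype B]

theorem exists_dual_vectors [DecidableEq A] [DecidableEq B] (N : Set A) (u : A → B → ℝ)
    (hu : LinearIndependent ℝ (fun a : N => u a)) :
    ∃ p : A → B → ℝ, ∀ a ∈ N, ∀ b ∈ N, u a ⬝ᵥ p b = if a = b then 1 else 0 := by
  classical
  obtain ⟨L, hL⟩ := (Fintype.linearCombination ℝ (fun a : N => u a)).exists_leftInverse_of_injective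
    (LinearMap.ker_eq_bot.2 (linearIndependent_iff_injective_fintypeLinearCombination.1 hu))
  -- `L` recovers the coefficients of a combination of the u_a, so p_b is the b-th component of `L`,
  -- read on the standard basis.
  refine ⟨fun b β => if hb : b ∈ N then L (Pi.single β 1) ⟨b, hb⟩ else 0, ?_⟩
  intro a ha b hb
  have h1 : L (u a) = Pi.single ⟨a, ha⟩ 1 := by
    have := LinearMap.congr_fun hL (Pi.single ⟨a, ha⟩ 1)
    simpa using this
  have h2 : u a = ∑ β, u a β • (Pi.single β (1 : ℝ) : B → ℝ) := by
    funext β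
    simp [Finset.sum_apply, Pi.single_apply]
  have h3 : L (u a) ⟨b, hb⟩ = ∑ β, u a β * L (Pi.single β 1) ⟨b, hb⟩ := by
    conv_lhs => rw [h2]
    simp
  simp only [dotProduct, dif_pos hb]
  rw [← h3, h1, Pi.single_apply]
  simp [eq_comm]

theorem symmetricProduct_contract {u w : A → B → ℝ}
    (h : ∀ α β, ∑ e, (u e α * w e β + u e β * w e α) = 0) (x y : B → ℝ) :
    ∑ e, ((u e ⬝ᵥ x) * (w e ⬝ᵥ y) + (u e ⬝ᵥ y) * (w e ⬝ᵥ x)) = 0 := by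
  have h1 : ∀ e, (u e ⬝ᵥ x) * (w e ⬝ᵥ y) + (u e ⬝ᵥ y) * (w e ⬝ᵥ x)
      = ∑ α, ∑ β, x α * y β * (u e α * w e β + u e β * w e α) := by
    intro e
    have h2 : (u e ⬝ᵥ y) * (w e ⬝ᵥ x) = (w e ⬝ᵥ x) * (u e ⬝ᵥ y) := mul_comm _ _
    rw [h2]
    simp only [dotProduct, Finset.sum_mul_sum, ← Finset.sum_add_distrib]
    exact Finset.sum_congr rfl fun α _ => Finset.sum_congr rfl fun β _ => by ring
  simp only [h1]
  rw [Finset.sum_comm]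
  refine Finset.sum_eq_zero fun α _ => ?_
  rw [Finset.sum_comm]
  refine Finset.sum_eq_zero fun β _ => ?_
  rw [← Finset.mul_sum, h, mul_zero]

variable [DecidableEq A] {N : Set A} {u w : A → B → ℝ} {p : A → B → ℝ}

/-- Contracting Σ u_e ⊙ w_e = 0 with p_d and with an x killed by every u_a leaves only w_d · x. -/
theorem symmetricProduct_annihilator (hu : ∀ a ∉ N, u a = 0)
    (hp : ∀ a ∈ N, ∀ b ∈ N, u a ⬝ᵥ p b = if a = b then 1 else 0)
    (h : ∀ α β, ∑ e, (u e α * w e β + u e β * w e α) = 0) {d : A} (hd : d ∈ N) {x : B → ℝ}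
    (hx : ∀ a ∈ N, u a ⬝ᵥ x = 0) : w d ⬝ᵥ x = 0 := by
  have h1 := symmetricProduct_contract h (p d) x
  have h2 : ∀ e, (u e ⬝ᵥ p d) * (w e ⬝ᵥ x) + (u e ⬝ᵥ x) * (w e ⬝ᵥ p d)
      = if e = d then w e ⬝ᵥ x else 0 := by
    intro e
    by_cases he : e ∈ N
    · rw [hp e he d hd, hx e he]
      simp
    · have : e ≠ d := fun h => he (h ▸ hd)
      simp [hu e he, this]
  simpa [h2] using h1

/-- Contraction of Σ u_e ⊙ w_e = 0 with p_d and p_c: the matrix w_d · p_c is antisymmetric. -/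
theorem symmetricProduct_pair (hu : ∀ a ∉ N, u a = 0)
    (hp : ∀ a ∈ N, ∀ b ∈ N, u a ⬝ᵥ p b = if a = b then 1 else 0)
    (h : ∀ α β, ∑ e, (u e α * w e β + u e β * w e α) = 0) {d c : A} (hd : d ∈ N) (hc : c ∈ N) :
    w d ⬝ᵥ p c + w c ⬝ᵥ p d = 0 := by
  have h1 := symmetricProduct_contract h (p d) (p c)
  have h2 : ∀ e, (u e ⬝ᵥ p d) * (w e ⬝ᵥ p c) + (u e ⬝ᵥ p c) * (w e ⬝ᵥ p d)
      = (if e = d then w e ⬝ᵥ p c else 0) + (if e = c then w e ⬝ᵥ p d else 0) := by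
    intro e
    by_cases he : e ∈ N
    · rw [hp e he d hd, hp e he c hc]
      simp
    · have h3 : e ≠ d := fun h => he (h ▸ hd)
      have h4 : e ≠ c := fun h => he (h ▸ hc)
      simp [hu e he, h3, h4]
  simpa [h2, Finset.sum_add_distrib] using h1

theorem dotProduct_eq_sum_dual (hu : ∀ a ∉ N, u a = 0)
    (hp : ∀ a ∈ N, ∀ b ∈ N, u a ⬝ᵥ p b = if a = b then 1 else 0) {v : B → ℝ}
    (hv : ∀ x, (∀ a ∈ N, u a ⬝ᵥ x = 0) → v ⬝ᵥ x = 0) {c : A}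
    (hvp : ∀ e ∈ N, e ≠ c → v ⬝ᵥ p e = 0) : v = (v ⬝ᵥ p c) • u c := by
  classical
  funext β
  -- The vector e_β − Σ u_e^β p_e is killed by every u_a, hence by v. This expresses v^β through the
  -- numbers v · p_e.
  have h1 := hv (Pi.single β 1 - ∑ e, u e β • p e) (by
    intro a ha
    rw [dotProduct_sub, dotProduct_sum]
    have : ∀ e, u a ⬝ᵥ u e β • p e = if e = a then u a β else 0 := by
      intro e
      by_cases he : e ∈ N
      · rw [dotProduct_smul, hp a ha e he]
        by_cases hea : e = a
        · simp [hea]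
        · simp [hea, Ne.symm hea]
      · have : e ≠ a := fun h => he (h ▸ ha)
        simp [hu e he, this]
    simp [this])
  have h2 : ∀ e, v ⬝ᵥ u e β • p e = if e = c then u c β * (v ⬝ᵥ p c) else 0 := by
    intro e
    by_cases hec : e = c
    · simp [hec, dotProduct_smul]
    · by_cases he : e ∈ N
      · simp [hec, dotProduct_smul, hvp e he hec]
      · simp [hec, hu e he]
  rw [dotProduct_sub, dotProduct_sum] at h1
  simp only [h2, Finset.sum_ite_eq', Finset.mem_univ, if_true, dotProduct_single, mul_one] at h1
  simp only [Pi.smul_apply, smul_eq_mul]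
  linarith

variable {M : Type*} [Fintype M]

/-- The hypothesis reads Σ u_e ⊙ w_e = 0 with w_e = (l_e − l_c) v_e − dl_e u_c. Combinations over
`b` realise every vector of eigenvalues. The one concentrated at d ≠ c isolates v_d and forces it to
be a multiple of u_c. Each w_e with e in `N` is then a multiple of u_c, and the antisymmetric
pairing with p_c makes its coefficient zero. -/
theorem null_components_eq_zero (hu : ∀ a ∉ N, u a = 0)
    (hp : ∀ a ∈ N, ∀ b ∈ N, u a ⬝ᵥ p b = if a = b then 1 else 0)
    {l : M → A → ℝ} (hl : ∀ μ : A → ℝ, ∃ s : M → ℝ, ∀ a, ∑ b, s b * l b a = μ a)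
    {dl : M → A → ℝ} {v : A → B → ℝ} {c : A} (hc : c ∈ N)
    (h : ∀ b α β, ∑ e, (u e α * ((l b e - l b c) * v e β - dl b e * u c β)
      + u e β * ((l b e - l b c) * v e α - dl b e * u c α)) = 0) :
    ∀ b, ∀ e ∈ N, ∀ β, (l b e - l b c) * v e β - dl b e * u c β = 0 := by
  have key : ∀ μ : A → ℝ, ∃ ν : A → ℝ, ∀ α β,
      ∑ e, (u e α * ((μ e - μ c) • v e - ν e • u c) β
        + u e β * ((μ e - μ c) • v e - ν e • u c) α) = 0 := by
    intro μ
    obtain ⟨s, hs⟩ := hl μ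
    refine ⟨fun e => ∑ b, s b * dl b e, fun α β => ?_⟩
    have h1 : ∑ b, s b * ∑ e, (u e α * ((l b e - l b c) * v e β - dl b e * u c β)
      + u e β * ((l b e - l b c) * v e α - dl b e * u c α)) = 0 :=
      Finset.sum_eq_zero fun b _ => by rw [h, mul_zero]
    rw [← h1]
    simp only [Finset.mul_sum]
    rw [Finset.sum_comm]
    refine Finset.sum_congr rfl fun e _ => ?_
    simp only [Pi.sub_apply, Pi.smul_apply, smul_eq_mul, ← hs, Finset.sum_mul, Finset.mul_sum,
      ← Finset.sum_sub_distrib, ← Finset.sum_add_distrib]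
    exact Finset.sum_congr rfl fun b _ => by ring
  have hcp : ∀ e ∈ N, e ≠ c → u c ⬝ᵥ p e = 0 := fun e he hec => by
    rw [hp c hc e he, if_neg (Ne.symm hec)]
  have hv : ∀ e ∈ N, e ≠ c → v e = (v e ⬝ᵥ p c) • u c := by
    intro d hd hdc
    refine dotProduct_eq_sum_dual hu hp (fun x hx => ?_) (fun e he hec => ?_)
    · obtain ⟨ν, hν⟩ := key (Pi.single d 1)
      have := symmetricProduct_annihilator hu hp hν hd hx
      simpa [sub_dotProduct, smul_dotProduct, hx c hc, Ne.symm hdc] using this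
    · obtain ⟨ν, hν⟩ := key (Pi.single d 1)
      have := symmetricProduct_pair hu hp hν hd he
      by_cases hed : e = d
      · subst hed
        simpa [sub_dotProduct, smul_dotProduct, Ne.symm hdc, hcp e he hec] using this
      · simpa [sub_dotProduct, smul_dotProduct, Ne.symm hdc, Ne.symm hec, hed, hcp e he hec,
          hcp d hd hdc] using this
  intro b
  have hb : ∀ α β, ∑ e, (u e α * ((l b e - l b c) • v e - dl b e • u c) β
        + u e β * ((l b e - l b c) • v e - dl b e • u c) α) = 0 := fun α β => by
    simpa using h b α β
  -- In w_c the coefficient of v_c is zero, so w_c = −dl_c u_c; antisymmetry gives w_c · p_c = 0.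
  have hcc : dl b c = 0 := by
    have := symmetricProduct_pair hu hp hb hc hc
    simp only [sub_self, zero_smul, zero_sub, neg_dotProduct, smul_dotProduct, hp c hc c hc,
      if_true, smul_eq_mul, mul_one] at this
    linarith
  intro e he β
  by_cases hec : e = c
  · simp [hec, hcc]
  · have := symmetricProduct_pair hu hp hb he hc
    rw [hv e he hec] at this ⊢
    simp only [sub_self, zero_smul, smul_dotProduct, hp c hc c hc, hcc,
      sub_dotProduct, if_true, smul_eq_mul, mul_one, zero_dotProduct, add_zero] at this
    simp only [Pi.smul_apply, smul_eq_mul]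
    linear_combination u c β * this

/-- The algebraic content of the Killing equation at a point: `g` and `dg` stand for the metric and
its derivatives, `T b e` for `λ_b^e ∂_e G - ∂_e K_b`. -/
theorem killing_components_eq_zero {g : A ⊕ B → A ⊕ B → ℝ} {dg : A → A ⊕ B → A ⊕ B → ℝ}
    {T : M → A → A ⊕ B → A ⊕ B → ℝ} {l : M → A → ℝ} {dl : M → A → A → ℝ}
    (hT : ∀ b a i j, T b a i j = T b a j i)
    (hTe : ∀ b a c j, T b a (.inl c) j
      = (l b a - l b c) * dg a (.inl c) j - dl b a c * g (.inl c) j)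
    (horth : ∀ a c, a ≠ c → g (.inl a) (.inl c) = 0)
    (hdorth : ∀ e a c, a ≠ c → dg e (.inl a) (.inl c) = 0)
    (hnull : ∀ a ∈ N, g (.inl a) (.inl a) = 0)
    (hdnull : ∀ e, ∀ a ∈ N, dg e (.inl a) (.inl a) = 0)
    (hreg : ∀ a ∉ N, g (.inl a) (.inl a) ≠ 0)
    (hregB : ∀ a ∉ N, ∀ β, g (.inl a) (.inr β) = 0)
    (hdregB : ∀ e, ∀ a ∉ N, ∀ β, dg e (.inl a) (.inr β) = 0)
    (hp : ∀ a ∈ N, ∀ b ∈ N, (fun β => g (.inl a) (.inr β)) ⬝ᵥ p b = if a = b then 1 else 0)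
    (hl : ∀ μ : A → ℝ, ∃ s : M → ℝ, ∀ a, ∑ b, s b * l b a = μ a)
    (hK : ∀ b i j h, ∑ e, (g (.inl e) i * T b e j h + g (.inl e) j * T b e h i
      + g (.inl e) h * T b e i j) = 0) :
    ∀ b a c j, T b a (.inl c) j = 0 := by
  -- In these three cases both the metric component and its derivatives vanish. What remains is
  -- T^{cc} with c non-null and T^{cβ} with c null.
  have E0 : ∀ b e a c, a ≠ c → T b e (.inl a) (.inl c) = 0 := by
    intro b e a c hac
    rw [hTe, horth a c hac, hdorth e a c hac]
    ring
  have E1 : ∀ b e, ∀ a ∉ N, ∀ β, T b e (.inl a) (.inr β) = 0 := by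
    intro b e a ha β
    rw [hTe, hregB a ha, hdregB e a ha]
    ring
  have E2 : ∀ b e, ∀ a ∈ N, T b e (.inl a) (.inl a) = 0 := by
    intro b e a ha
    rw [hTe, hnull a ha, hdnull e a ha]
    ring
  have hsum : ∀ a, ∀ F : A → ℝ, ∑ e, g (.inl e) (.inl a) * F e = g (.inl a) (.inl a) * F a := by
    intro a F
    refine Finset.sum_eq_single a (fun e _ hea => ?_) (by simp)
    rw [horth e a hea, zero_mul]
  intro b a c j
  by_cases ha : a ∈ N
  · by_cases hc : c ∈ N
    · rcases j with d | β
      · by_cases hdc : c = d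
        · subst hdc
          exact E2 b a c hc
        · exact E0 b a c d hdc
      · have h1 := null_components_eq_zero (N := N) (u := fun a β => g (.inl a) (.inr β)) (p := p)
          (l := l) (dl := fun b e => dl b e c) (v := fun e β => dg e (.inl c) (.inr β)) (c := c)
          (fun a ha => funext fun β => hregB a ha β) hp hl hc (by
            intro b α β
            have := hK b (.inl c) (.inr α) (.inr β)
            simp only [Finset.sum_add_distrib, hsum c, hnull c hc, zero_mul, zero_add,
              hT b _ (.inr β) (.inl c), hTe] at this
            simpa only [Finset.sum_add_distrib] using this)
        rw [hTe]
        exact h1 b a ha β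
    · rcases j with d | β
      · by_cases hdc : c = d
        · subst hdc
          -- The index triple (c, c, β) leaves this sum; contraction with p_a then selects e = a.
          have h1 : ∀ β, ∑ e, g (.inl e) (.inr β) * T b e (.inl c) (.inl c) = 0 := by
            intro β
            have := hK b (.inl c) (.inl c) (.inr β)
            simpa [Finset.sum_add_distrib, hsum, E1 b _ c hc, hT b _ (.inr β) (.inl c)] using this
          have h2 : ∑ β, p a β * ∑ e, g (.inl e) (.inr β) * T b e (.inl c) (.inl c) = 0 :=
            Finset.sum_eq_zero fun β _ => by rw [h1, mul_zero]
          simp only [Finset.mul_sum] at h2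
          rw [Finset.sum_comm, Finset.sum_eq_single a] at h2
          · rw [← h2]
            have h3 := hp a ha a ha
            simp only [dotProduct, if_true] at h3
            calc T b a (.inl c) (.inl c)
                = (∑ β, g (.inl a) (.inr β) * p a β) * T b a (.inl c) (.inl c) := by
                  rw [h3, one_mul]
              _ = _ := by
                  rw [Finset.sum_mul]
                  exact Finset.sum_congr rfl fun β _ => by ring
          · intro e _ hea
            by_cases he : e ∈ N
            · have h3 := hp e he a ha
              simp only [dotProduct, if_neg hea] at h3
              calc _ = (∑ β, g (.inl e) (.inr β) * p a β) * T b e (.inl c) (.inl c) := by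
                    rw [Finset.sum_mul]
                    exact Finset.sum_congr rfl fun β _ => by ring
                _ = 0 := by rw [h3, zero_mul]
            · exact Finset.sum_eq_zero fun β _ => by simp [hregB e he]
          · simp
        · exact E0 b a c d hdc
      · exact E1 b a c hc β
  -- For non-null a, in the cases left, the index triple (a, c, j) reduces to a nonzero multiple of
  -- g^{aa} T_a^{cj}.
  · have hcancel : ∀ x, g (.inl a) (.inl a) * x = 0 → x = 0 := fun x hx =>
      (mul_eq_zero.1 hx).resolve_left (hreg a ha)
    rcases j with d | β
    · by_cases hdc : c = d
      · subst hdc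
        by_cases hac : c = a
        · subst hac
          have := hK b (.inl c) (.inl c) (.inl c)
          simp only [Finset.sum_add_distrib, hsum] at this
          exact hcancel _ (by linarith)
        · have := hK b (.inl a) (.inl c) (.inl c)
          simp only [hsum, E0 b _ c a hac, E0 b _ a c (Ne.symm hac),
            mul_zero, add_zero] at this
          exact hcancel _ this
      · exact E0 b a c d hdc
    · by_cases hc : c ∈ N
      · have hac : a ≠ c := fun h => ha (h ▸ hc)
        have := hK b (.inl a) (.inl c) (.inr β)
        simp only [hsum, E0 b _ a c hac, hT b _ (.inr β) (.inl a),
            E1 b _ a ha, mul_zero, add_zero] at this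
        exact hcancel _ this
      · exact E1 b a c hc β

end KillingEquation

/-! ### The ignorable block of the Killing equation -/

section IgnorableBlock

variable {A B : Type*} [Fintype A] {N : Set A}

/-- The ignorable block of the Killing equation when at most one essential direction is null. -/
theorem killing_ignorable_block_eq_zero {g : A ⊕ B → A ⊕ B → ℝ}
    {T : A → A ⊕ B → A ⊕ B → ℝ} (hT : ∀ a i j, T a i j = T a j i)
    (horth : ∀ a c, a ≠ c → g (.inl a) (.inl c) = 0)
    (hreg : ∀ a ∉ N, g (.inl a) (.inl a) ≠ 0)
    (hregB : ∀ a ∉ N, ∀ β, g (.inl a) (.inr β) = 0)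
    (hnz : ∀ a ∈ N, ∃ β, g (.inl a) (.inr β) ≠ 0) (hN : N.Subsingleton)
    (hTe : ∀ a c j, T a (.inl c) j = 0)
    (hK : ∀ i j h, ∑ e, (g (.inl e) i * T e j h + g (.inl e) j * T e h i
      + g (.inl e) h * T e i j) = 0) (a : A) (α β : B) :
    T a (.inr α) (.inr β) = 0 := by
  by_cases ha : a ∈ N
  · have h1 : ∀ α β γ, g (.inl a) (.inr α) * T a (.inr β) (.inr γ)
        + g (.inl a) (.inr β) * T a (.inr γ) (.inr α)
        + g (.inl a) (.inr γ) * T a (.inr α) (.inr β) = 0 := by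
      intro α β γ
      rw [← hK (.inr α) (.inr β) (.inr γ)]
      symm
      refine Finset.sum_eq_single a (fun e _ hea => ?_) (by simp)
      have he : e ∉ N := fun h => hea (hN h ha)
      simp [hregB e he]
    obtain ⟨γ, hγ⟩ := hnz a ha
    have h2 : T a (.inr γ) (.inr γ) = 0 := by
      have := h1 γ γ γ
      exact (mul_eq_zero.1 (show g (.inl a) (.inr γ) * T a (.inr γ) (.inr γ) = 0 by
        linarith)).resolve_left hγ
    have h3 : ∀ β, T a (.inr γ) (.inr β) = 0 := by
      intro β
      have := h1 γ γ β
      rw [h2, hT a (.inr β) (.inr γ)] at this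
      exact (mul_eq_zero.1 (show g (.inl a) (.inr γ) * T a (.inr γ) (.inr β) = 0 by
        linarith)).resolve_left hγ
    have := h1 γ α β
    rw [h3, hT a (.inr β) (.inr γ), h3] at this
    exact (mul_eq_zero.1 (show g (.inl a) (.inr γ) * T a (.inr α) (.inr β) = 0 by
        linarith)).resolve_left hγ
  · have := hK (.inl a) (.inr α) (.inr β)
    simp only [hTe, hT _ (.inr β) (.inl a), mul_zero, add_zero] at this
    rw [Finset.sum_eq_single a (fun e _ hea => by rw [horth e a hea, zero_mul]) (by simp)] at this
    exact (mul_eq_zero.1 this).resolve_left (hreg a ha)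

end IgnorableBlock

/-! ### Smoothness of determinants and inverse matrices -/

section SmoothMatrices

variable {E : Type*} [NormedAddCommGroup E] [NormedSpace ℝ E] {V : Set E} {n : Type*} [Fintype n]
  [DecidableEq n]

theorem contDiffOn_det {M : E → Matrix n n ℝ} (h : ∀ i j, ContDiffOn ℝ ∞ (fun y => M y i j) V) :
    ContDiffOn ℝ ∞ (fun y => (M y).det) V := by
  simp only [Matrix.det_apply]
  refine ContDiffOn.sum fun σ _ => ?_
  exact (contDiffOn_prod fun i _ => h _ _).const_smul _

theorem contDiffOn_inv_entry {M : E → Matrix n n ℝ}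
    (h : ∀ i j, ContDiffOn ℝ ∞ (fun y => M y i j) V) (hd : ∀ y ∈ V, (M y).det ≠ 0) (i j : n) :
    ContDiffOn ℝ ∞ (fun y => (M y)⁻¹ i j) V := by
  have h1 : ContDiffOn ℝ ∞ (fun y => (M y).adjugate i j) V := by
    simp only [Matrix.adjugate_apply]
    refine contDiffOn_det fun a b => ?_
    by_cases ha : a = j
    · subst ha
      simpa using contDiffOn_const
    · simpa [Matrix.updateRow_ne ha] using h a b
  refine (((contDiffOn_det h).inv hd).mul h1).congr fun y _ => ?_
  simp [Matrix.inv_def]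

end SmoothMatrices

/-- A metric `g` and Killing tensors `κ_b`, in coordinates on `V`, that do not depend on the
ignorable coordinates and have the common orthogonal eigenforms `dq^a` with eigenvalues `Λ_b^a`. -/
structure CoordAlgebra {k r : ℕ} (V : Set (Coord k r))
    (g : Fin (k + 1) ⊕ Fin r → Fin (k + 1) ⊕ Fin r → Coord k r → ℝ)
    (κ : Fin (k + 1) → Fin (k + 1) ⊕ Fin r → Fin (k + 1) ⊕ Fin r → Coord k r → ℝ)
    (Λ : Coord k r → Matrix (Fin (k + 1)) (Fin (k + 1)) ℝ) (N : Set (Fin (k + 1))) : Prop where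
  isOpen : IsOpen V
  convex : Convex ℝ V
  smooth_g : ∀ i j, ContDiffOn ℝ ∞ (g i j) V
  smooth_κ : ∀ b i j, ContDiffOn ℝ ∞ (κ b i j) V
  symm_g : ∀ y ∈ V, ∀ i j, g i j y = g j i y
  symm_κ : ∀ y ∈ V, ∀ b i j, κ b i j y = κ b j i y
  ign_g : ∀ y ∈ V, ∀ α i j, pd (Sum.inr α) (g i j) y = 0
  ign_κ : ∀ y ∈ V, ∀ b α i j, pd (Sum.inr α) (κ b i j) y = 0
  eigen : ∀ y ∈ V, ∀ b a j, κ b (Sum.inl a) j y = Λ y b a * g (Sum.inl a) j y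
  orth : ∀ y ∈ V, ∀ a c, a ≠ c → g (Sum.inl a) (Sum.inl c) y = 0
  null : ∀ y ∈ V, ∀ a ∈ N, g (Sum.inl a) (Sum.inl a) y = 0
  nonnull : ∀ y ∈ V, ∀ a ∉ N, g (Sum.inl a) (Sum.inl a) y ≠ 0
  origin : ∀ y ∈ V, ∀ a ∉ N, ∀ β, g (Sum.inl a) (Sum.inr β) y = 0
  indep : ∀ y ∈ V, LinearIndependent ℝ (fun (a : Fin (k + 1)) j => g (Sum.inl a) j y)
  det : ∀ y ∈ V, (Λ y).det ≠ 0
  last : ∀ y ∈ V, ∀ a, Λ y (Fin.last k) a = 1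
  bracket : ∀ y ∈ V, ∀ b i j h,
    ∑ l, (κ b l i y * pd l (g j h) y + κ b l j y * pd l (g h i) y + κ b l h y * pd l (g i j) y
        - g l i y * pd l (κ b j h) y - g l j y * pd l (κ b h i) y
        - g l h y * pd l (κ b i j) y) = 0

/-- The components `g` are in the standard form given by a Stäckel matrix on `V`. -/
structure StackelForm {k r : ℕ} (V : Set (Coord k r))
    (g : Fin (k + 1) ⊕ Fin r → Fin (k + 1) ⊕ Fin r → Coord k r → ℝ)
    (κ : Fin (k + 1) → Fin (k + 1) ⊕ Fin r → Fin (k + 1) ⊕ Fin r → Coord k r → ℝ)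
    (Λ : Coord k r → Matrix (Fin (k + 1)) (Fin (k + 1)) ℝ) (N : Set (Fin (k + 1)))
    (S : Fin (k + 1) → Fin (k + 1) → ℝ → ℝ) (θ : Fin (k + 1) → Fin r → ℝ → ℝ)
    (η : Fin (k + 1) → Fin r → Fin r → ℝ → ℝ) : Prop where
  smooth_S : ∀ a b, ContDiffOn ℝ ∞ (S a b) ((fun y : Coord k r => y (Sum.inl a)) '' V)
  smooth_θ : ∀ a β, ContDiffOn ℝ ∞ (θ a β) ((fun y : Coord k r => y (Sum.inl a)) '' V)
  smooth_η : ∀ a α β, ContDiffOn ℝ ∞ (η a α β) ((fun y : Coord k r => y (Sum.inl a)) '' V)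
  regular : ∀ y ∈ V, (stackelMatrix S y).det ≠ 0
  phi_ne_zero : ∀ y ∈ V, ∀ a, phi S (Fin.last k) a y ≠ 0
  eigen : ∀ y ∈ V, ∀ b a, phi S b a y = Λ y b a * phi S (Fin.last k) a y
  diag : ∀ y ∈ V, ∀ b, ∀ a ∉ N, κ b (.inl a) (.inl a) y = phi S b a y
  isotropic : ∀ y ∈ V, ∀ b, ∀ a ∈ N, ∀ β,
    κ b (.inl a) (.inr β) y = θ a β (y (.inl a)) * phi S b a y
  block : ∀ y ∈ V, ∀ α β, g (.inr α) (.inr β) y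
    = ∑ a, η a α β (y (.inl a)) * phi S (Fin.last k) a y

/-! ### From the Killing equations to a Stäckel matrix -/

namespace CoordAlgebra

variable {k r : ℕ} {V : Set (Coord k r)}
  {g : Fin (k + 1) ⊕ Fin r → Fin (k + 1) ⊕ Fin r → Coord k r → ℝ}
  {κ : Fin (k + 1) → Fin (k + 1) ⊕ Fin r → Fin (k + 1) ⊕ Fin r → Coord k r → ℝ}
  {Λ : Coord k r → Matrix (Fin (k + 1)) (Fin (k + 1)) ℝ} {N : Set (Fin (k + 1))}
  {y : Coord k r}

theorem exists_row_ne_zero (H : CoordAlgebra V g κ Λ N) (hy : y ∈ V) (a : Fin (k + 1)) :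
    ∃ j, g (.inl a) j y ≠ 0 := by
  by_contra! h
  exact (H.indep y hy).ne_zero a (funext h)

theorem exists_null_row_ne_zero (H : CoordAlgebra V g κ Λ N) (hy : y ∈ V) {a : Fin (k + 1)}
    (ha : a ∈ N) : ∃ β, g (.inl a) (.inr β) y ≠ 0 := by
  obtain ⟨j, hj⟩ := H.exists_row_ne_zero hy a
  rcases j with c | β
  · by_cases hac : a = c
    · subst hac
      exact absurd (H.null y hy a ha) hj
    · exact absurd (H.orth y hy a c hac) hj
  · exact ⟨β, hj⟩

/-- The essential entries of a null row all vanish, so dropping them preserves independence. -/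
theorem indep_null (H : CoordAlgebra V g κ Λ N) (hy : y ∈ V) :
    LinearIndependent ℝ (fun (a : N) β => g (.inl (a : Fin (k + 1))) (.inr β) y) := by
  have h1 := (H.indep y hy).comp (fun a : N => (a : Fin (k + 1))) Subtype.val_injective
  rw [linearIndependent_iff'] at h1 ⊢
  intro s c hc
  refine h1 s c ?_
  funext j
  rcases j with d | β
  · simp only [Finset.sum_apply, Pi.smul_apply, Function.comp_apply, Pi.zero_apply]
    refine Finset.sum_eq_zero fun a _ => ?_
    by_cases had : (a : Fin (k + 1)) = d
    · subst had
      rw [H.null y hy a a.2, smul_zero]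
    · rw [H.orth y hy _ _ had, smul_zero]
  · simpa using congrFun hc β

/-- The common factor of the components `g^{aj}`, up to a function of `q^a`. -/
def scale (g : Fin (k + 1) ⊕ Fin r → Fin (k + 1) ⊕ Fin r → Coord k r → ℝ)
    (N : Set (Fin (k + 1))) (a : Fin (k + 1)) (y : Coord k r) : ℝ := by
  classical
  exact if a ∈ N then √(∑ β, g (.inl a) (.inr β) y ^ 2) else g (.inl a) (.inl a) y

theorem sum_sq_pos (H : CoordAlgebra V g κ Λ N) (hy : y ∈ V) {a : Fin (k + 1)} (ha : a ∈ N) :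
    0 < ∑ β, g (.inl a) (.inr β) y ^ 2 := by
  obtain ⟨β, hβ⟩ := H.exists_null_row_ne_zero hy ha
  exact Finset.sum_pos' (fun _ _ => sq_nonneg _) ⟨β, Finset.mem_univ _, by positivity⟩

theorem scale_ne_zero (H : CoordAlgebra V g κ Λ N) (hy : y ∈ V) (a : Fin (k + 1)) :
    scale g N a y ≠ 0 := by
  unfold scale
  split_ifs with ha
  · exact (Real.sqrt_pos.2 (H.sum_sq_pos hy ha)).ne'
  · exact H.nonnull y hy a ha

theorem scale_sq (H : CoordAlgebra V g κ Λ N) (hy : y ∈ V) {a : Fin (k + 1)} (ha : a ∈ N) :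
    scale g N a y * scale g N a y = ∑ β, g (.inl a) (.inr β) y * g (.inl a) (.inr β) y := by
  simp only [scale, if_pos ha]
  rw [Real.mul_self_sqrt (H.sum_sq_pos hy ha).le]
  exact Finset.sum_congr rfl fun β _ => sq _

theorem smooth_scale (H : CoordAlgebra V g κ Λ N) (a : Fin (k + 1)) :
    ContDiffOn ℝ ∞ (scale g N a) V := by
  by_cases ha : a ∈ N
  · have h1 : ContDiffOn ℝ ∞ (fun y => ∑ β, g (.inl a) (.inr β) y ^ 2) V :=
      ContDiffOn.sum fun β _ => (H.smooth_g _ _).pow 2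
    exact (h1.sqrt fun y hy => (H.sum_sq_pos hy ha).ne').congr fun y _ => by simp [scale, ha]
  · exact (H.smooth_g (.inl a) (.inl a)).congr fun y _ => by simp [scale, ha]

/-- The matrix `K_b^{aa}`, or `K_b^{aβ} / θ_a^β` for null `q^a`. -/
def colMatrix (g : Fin (k + 1) ⊕ Fin r → Fin (k + 1) ⊕ Fin r → Coord k r → ℝ)
    (Λ : Coord k r → Matrix (Fin (k + 1)) (Fin (k + 1)) ℝ)
    (N : Set (Fin (k + 1))) (y : Coord k r) : Matrix (Fin (k + 1)) (Fin (k + 1)) ℝ :=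
  Matrix.of fun b a => Λ y b a * scale g N a y

/-- `Λ` is not assumed smooth. Its smoothness is extracted from the components of the K_b: for null
q^a, λ σ = (Σ K^{aβ} g^{aβ}) / σ because σ² = Σ (g^{aβ})². -/
theorem smooth_colMatrix (H : CoordAlgebra V g κ Λ N) (b a : Fin (k + 1)) :
    ContDiffOn ℝ ∞ (fun y => colMatrix g Λ N y b a) V := by
  by_cases ha : a ∈ N
  · have h1 : ContDiffOn ℝ ∞ (fun y => (∑ β, κ b (.inl a) (.inr β) y * g (.inl a) (.inr β) y) /
        scale g N a y) V :=
      (ContDiffOn.sum fun β _ => (H.smooth_κ _ _ _).mul (H.smooth_g _ _)).div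
        (H.smooth_scale a) fun y hy => H.scale_ne_zero hy a
    refine h1.congr fun y hy => ?_
    rw [eq_div_iff (H.scale_ne_zero hy a)]
    simp only [colMatrix, Matrix.of_apply, mul_assoc, H.scale_sq hy ha, Finset.mul_sum,
      H.eigen y hy]
  · refine (H.smooth_κ b (.inl a) (.inl a)).congr fun y hy => ?_
    simp [colMatrix, scale, ha, H.eigen y hy]

theorem smooth_Λ (H : CoordAlgebra V g κ Λ N) (b a : Fin (k + 1)) :
    ContDiffOn ℝ ∞ (fun y => Λ y b a) V := by
  refine ((H.smooth_colMatrix b a).div (H.smooth_scale a)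
    fun y hy => H.scale_ne_zero hy a).congr fun y hy => ?_
  have := H.scale_ne_zero hy a
  simp only [colMatrix, Matrix.of_apply, Pi.div_apply]
  field_simp

theorem det_colMatrix (H : CoordAlgebra V g κ Λ N) (hy : y ∈ V) :
    (colMatrix g Λ N y).det ≠ 0 := by
  have : colMatrix g Λ N y = Λ y * Matrix.diagonal (fun a => scale g N a y) := by
    ext b a
    simp [colMatrix, Matrix.mul_diagonal]
  rw [this, Matrix.det_mul, Matrix.det_diagonal]
  exact mul_ne_zero (H.det y hy) (Finset.prod_ne_zero_iff.2 fun a _ => H.scale_ne_zero hy a)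

theorem exists_combination (H : CoordAlgebra V g κ Λ N) (hy : y ∈ V) (μ : Fin (k + 1) → ℝ) :
    ∃ s : Fin (k + 1) → ℝ, ∀ a, ∑ b, s b * Λ y b a = μ a := by
  refine ⟨Matrix.vecMul μ (Λ y)⁻¹, fun a => ?_⟩
  change Matrix.vecMul (Matrix.vecMul μ (Λ y)⁻¹) (Λ y) a = _
  rw [Matrix.vecMul_vecMul, Matrix.nonsing_inv_mul _ (H.det y hy).isUnit, Matrix.vecMul_one]

theorem pd_eigen (H : CoordAlgebra V g κ Λ N) (hy : y ∈ V) (i : Fin (k + 1) ⊕ Fin r)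
    (b c : Fin (k + 1)) (j : Fin (k + 1) ⊕ Fin r) :
    pd i (κ b (.inl c) j) y = pd i (fun z => Λ z b c) y * g (.inl c) j y
      + Λ y b c * pd i (g (.inl c) j) y := by
  rw [pd_congr H.isOpen (fun z hz => H.eigen z hz b c j) hy]
  exact pd_mul (differentiableAt_of_smoothOn H.isOpen (H.smooth_Λ b c) hy)
    (differentiableAt_of_smoothOn H.isOpen (H.smooth_g _ _) hy)

/-- Ignorable derivatives drop out of the bracket, and K_b^{ei} = λ_b^e g^{ei} lets g^{ei} be
factored out of each remaining pair of terms. -/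
theorem killing_equation (H : CoordAlgebra V g κ Λ N) (hy : y ∈ V) (b : Fin (k + 1))
    (i j h : Fin (k + 1) ⊕ Fin r) :
    ∑ e, (g (.inl e) i y * (Λ y b e * pd (.inl e) (g j h) y - pd (.inl e) (κ b j h) y)
      + g (.inl e) j y * (Λ y b e * pd (.inl e) (g h i) y - pd (.inl e) (κ b h i) y)
      + g (.inl e) h y * (Λ y b e * pd (.inl e) (g i j) y - pd (.inl e) (κ b i j) y)) = 0 := by
  rw [← H.bracket y hy b i j h, Fintype.sum_sum_type]
  have h1 : ∀ α, pd (Sum.inr α) (g i j) y = 0 := fun α => H.ign_g y hy α i j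
  simp only [H.ign_g y hy, H.ign_κ y hy, H.eigen y hy, mul_zero, add_zero, sub_zero,
    Finset.sum_const_zero]
  exact Finset.sum_congr rfl fun e _ => by ring

theorem killing_row (H : CoordAlgebra V g κ Λ N) (hy : y ∈ V) (b a c : Fin (k + 1))
    (j : Fin (k + 1) ⊕ Fin r) :
    Λ y b a * pd (.inl a) (g (.inl c) j) y - pd (.inl a) (κ b (.inl c) j) y = 0 := by
  obtain ⟨p, hp⟩ := exists_dual_vectors N (fun a β => g (.inl a) (.inr β) y) (H.indep_null hy)
  refine killing_components_eq_zero (N := N) (p := p) (g := fun i j => g i j y)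
    (dg := fun e i j => pd (.inl e) (g i j) y)
    (T := fun b a i j => Λ y b a * pd (.inl a) (g i j) y - pd (.inl a) (κ b i j) y)
    (l := fun b a => Λ y b a) (dl := fun b a c => pd (.inl a) (fun z => Λ z b c) y)
    ?_ ?_ (H.orth y hy) ?_ (H.null y hy) ?_ (H.nonnull y hy) (H.origin y hy) ?_ hp
    (H.exists_combination hy) (H.killing_equation hy) b a c j
  · intro b a i j
    rw [pd_congr H.isOpen (fun z hz => H.symm_g z hz i j) hy,
      pd_congr H.isOpen (fun z hz => H.symm_κ z hz b i j) hy]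
  · intro b a c j
    simp only [H.pd_eigen hy]
    ring
  · exact fun e a c hac => pd_eq_zero_of_eq_const H.isOpen (fun z hz => H.orth z hz a c hac) hy
  · exact fun e a ha => pd_eq_zero_of_eq_const H.isOpen (fun z hz => H.null z hz a ha) hy
  · exact fun e a ha β =>
      pd_eq_zero_of_eq_const H.isOpen (fun z hz => H.origin z hz a ha β) hy

theorem killing_block (H : CoordAlgebra V g κ Λ N) (hN : N.Subsingleton) (hy : y ∈ V)
    (b a : Fin (k + 1)) (α β : Fin r) :
    pd (.inl a) (κ b (.inr α) (.inr β)) y = Λ y b a * pd (.inl a) (g (.inr α) (.inr β)) y := by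
  have := killing_ignorable_block_eq_zero (N := N) (g := fun i j => g i j y)
    (T := fun a i j => Λ y b a * pd (.inl a) (g i j) y - pd (.inl a) (κ b i j) y)
    (fun a i j => by
      rw [pd_congr H.isOpen (fun z hz => H.symm_g z hz i j) hy,
        pd_congr H.isOpen (fun z hz => H.symm_κ z hz b i j) hy])
    (H.orth y hy) (H.nonnull y hy) (H.origin y hy)
    (fun a ha => H.exists_null_row_ne_zero hy ha) hN (H.killing_row hy b) (H.killing_equation hy b)
    a α β
  linarith

/-- In `killing_row` with a = c the difference of eigenvalues is zero, which leaves ∂_c λ^c times a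
nonzero row. -/
theorem pd_Λ_self (H : CoordAlgebra V g κ Λ N) (hy : y ∈ V) (b c : Fin (k + 1)) :
    pd (.inl c) (fun z => Λ z b c) y = 0 := by
  obtain ⟨j, hj⟩ := H.exists_row_ne_zero hy c
  have := H.killing_row hy b c c j
  rw [H.pd_eigen hy] at this
  exact (mul_eq_zero.1 (show pd (.inl c) (fun z => Λ z b c) y * g (.inl c) j y = 0 by
    linarith)).resolve_right hj

theorem pd_inr_Λ (H : CoordAlgebra V g κ Λ N) (hy : y ∈ V) (α : Fin r) (b c : Fin (k + 1)) :
    pd (.inr α) (fun z => Λ z b c) y = 0 := by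
  obtain ⟨j, hj⟩ := H.exists_row_ne_zero hy c
  have := H.pd_eigen hy (.inr α) b c j
  rw [H.ign_κ y hy, H.ign_g y hy, mul_zero, add_zero] at this
  exact (mul_eq_zero.1 this.symm).resolve_right hj

/-- The logarithmic derivative of the row `g^{c·}` in a direction other than `q^c`. -/
theorem exists_log_derivative (H : CoordAlgebra V g κ Λ N) (hy : y ∈ V) {a c : Fin (k + 1)}
    (hac : a ≠ c) : ∃ ρ : ℝ, (∀ j, pd (.inl a) (g (.inl c) j) y = ρ * g (.inl c) j y) ∧
      ∀ b, pd (.inl a) (fun z => Λ z b c) y = (Λ y b a - Λ y b c) * ρ := by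
  -- The combination Σ s_b K_b has eigenvalue 1 on E_a and 0 on the other eigenvectors, so λ^a − λ^c
  -- becomes 1 and ∂_a g^{cj} can be solved for.
  obtain ⟨s, hs⟩ := H.exists_combination hy (Pi.single a 1)
  have h0 : ∀ b j, (Λ y b a - Λ y b c) * pd (.inl a) (g (.inl c) j) y
      = pd (.inl a) (fun z => Λ z b c) y * g (.inl c) j y := by
    intro b j
    have := H.killing_row hy b a c j
    rw [H.pd_eigen hy] at this
    linarith
  have h1 : ∀ j, pd (.inl a) (g (.inl c) j) y
      = (∑ b, s b * pd (.inl a) (fun z => Λ z b c) y) * g (.inl c) j y := by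
    intro j
    have h2 : ∑ b, s b * (Λ y b a - Λ y b c) = 1 := by
      simp [mul_sub, Finset.sum_sub_distrib, hs, hac.symm]
    rw [← one_mul (pd _ _ y), ← h2, Finset.sum_mul, Finset.sum_mul]
    refine Finset.sum_congr rfl fun b _ => ?_
    rw [mul_assoc, h0, mul_assoc]
  refine ⟨_, h1, fun b => ?_⟩
  obtain ⟨j, hj⟩ := H.exists_row_ne_zero hy c
  have := h0 b j
  rw [h1 j, ← mul_assoc] at this
  exact (mul_right_cancel₀ hj this).symm

/-- The scale is positively homogeneous of degree one in the row, so it inherits the logarithmic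
derivative. In the null case its square is differentiated. -/
theorem pd_scale (H : CoordAlgebra V g κ Λ N) (hy : y ∈ V) {i : Fin (k + 1) ⊕ Fin r}
    {c : Fin (k + 1)} {ρ : ℝ} (h : ∀ j, pd i (g (.inl c) j) y = ρ * g (.inl c) j y) :
    pd i (scale g N c) y = ρ * scale g N c y := by
  by_cases hc : c ∈ N
  · have hd := differentiableAt_of_smoothOn H.isOpen (H.smooth_scale c) hy
    have hg : ∀ j, DifferentiableAt ℝ (g (.inl c) j) y := fun j =>
      differentiableAt_of_smoothOn H.isOpen (H.smooth_g _ _) hy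
    have h1 := pd_congr (i := i) H.isOpen (fun z hz => H.scale_sq hz hc) hy
    rw [pd_mul hd hd, pd_sum _ fun β _ => (hg _).fun_mul (hg _)] at h1
    have h2 : ∀ β, pd i (fun z => g (.inl c) (.inr β) z * g (.inl c) (.inr β) z) y
        = 2 * ρ * (g (.inl c) (.inr β) y * g (.inl c) (.inr β) y) := by
      intro β
      rw [pd_mul (hg _) (hg _), h]
      ring
    simp only [h2, ← Finset.mul_sum, ← H.scale_sq hy hc] at h1
    refine mul_left_cancel₀ (H.scale_ne_zero hy c) ?_
    linarith
  · rw [pd_congr (g := g (.inl c) (.inl c)) H.isOpen (fun z _ => by simp [scale, hc]) hy, h]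
    simp [scale, hc]

theorem pd_colMatrix (H : CoordAlgebra V g κ Λ N) (hy : y ∈ V) (i : Fin (k + 1) ⊕ Fin r)
    (b c : Fin (k + 1)) : pd i (fun z => colMatrix g Λ N z b c) y
      = pd i (fun z => Λ z b c) y * scale g N c y + Λ y b c * pd i (scale g N c) y :=
  pd_mul (differentiableAt_of_smoothOn H.isOpen (H.smooth_Λ b c) hy)
    (differentiableAt_of_smoothOn H.isOpen (H.smooth_scale c) hy)

/-- The candidate for the Stäckel matrix. -/
def invMatrix (g : Fin (k + 1) ⊕ Fin r → Fin (k + 1) ⊕ Fin r → Coord k r → ℝ)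
    (Λ : Coord k r → Matrix (Fin (k + 1)) (Fin (k + 1)) ℝ)
    (N : Set (Fin (k + 1))) (y : Coord k r) : Matrix (Fin (k + 1)) (Fin (k + 1)) ℝ :=
  (colMatrix g Λ N y)⁻¹

theorem smooth_invMatrix (H : CoordAlgebra V g κ Λ N) (a b : Fin (k + 1)) :
    ContDiffOn ℝ ∞ (fun y => invMatrix g Λ N y a b) V :=
  contDiffOn_inv_entry H.smooth_colMatrix (fun _ hy => H.det_colMatrix hy) a b

theorem sum_inv_mul_col (H : CoordAlgebra V g κ Λ N) (hy : y ∈ V) (a c : Fin (k + 1)) :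
    ∑ b, invMatrix g Λ N y a b * colMatrix g Λ N y b c = if a = c then 1 else 0 := by
  have := congrFun (congrFun (Matrix.nonsing_inv_mul _ (H.det_colMatrix hy).isUnit) a) c
  rw [Matrix.mul_apply, Matrix.one_apply] at this
  exact this

/-- Differentiating row c of S P = 1 gives (∂_i S_c) P = −S_c ∂_i P, which is zero by hypothesis,
and P is invertible. -/
theorem pd_invMatrix_eq_zero_of (H : CoordAlgebra V g κ Λ N) (hy : y ∈ V)
    {i : Fin (k + 1) ⊕ Fin r} {c : Fin (k + 1)}
    (h : ∀ d, ∑ b, invMatrix g Λ N y c b * pd i (fun z => colMatrix g Λ N z b d) y = 0)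
    (b : Fin (k + 1)) : pd i (fun z => invMatrix g Λ N z c b) y = 0 := by
  have hS : ∀ b, DifferentiableAt ℝ (fun z => invMatrix g Λ N z c b) y := fun b =>
    differentiableAt_of_smoothOn H.isOpen (H.smooth_invMatrix c b) hy
  have hP : ∀ b d, DifferentiableAt ℝ (fun z => colMatrix g Λ N z b d) y := fun b d =>
    differentiableAt_of_smoothOn H.isOpen (H.smooth_colMatrix b d) hy
  have h1 : ∀ d, ∑ b, pd i (fun z => invMatrix g Λ N z c b) y * colMatrix g Λ N y b d = 0 := by
    intro d
    have h2 := pd_eq_zero_of_eq_const (i := i) H.isOpen (fun z hz => H.sum_inv_mul_col hz c d) hy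
    rw [pd_sum _ fun b _ => (hS b).fun_mul (hP b d)] at h2
    simp only [pd_mul (hS _) (hP _ d), Finset.sum_add_distrib, h d, add_zero] at h2
    exact h2
  have h3 : Matrix.vecMul (fun b => pd i (fun z => invMatrix g Λ N z c b) y)
      (colMatrix g Λ N y) = 0 := funext h1
  exact congrFun (Matrix.eq_zero_of_vecMul_eq_zero (H.det_colMatrix hy) h3) b

/-- Every column of ∂_a P is a multiple of the a-th column of P, and row c ≠ a of P⁻¹ annihilates
that column. Ignorable derivatives of P vanish. -/
theorem pd_invMatrix (H : CoordAlgebra V g κ Λ N) (hy : y ∈ V) {i : Fin (k + 1) ⊕ Fin r}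
    {c : Fin (k + 1)} (hi : i ≠ .inl c) (b : Fin (k + 1)) :
    pd i (fun z => invMatrix g Λ N z c b) y = 0 := by
  refine H.pd_invMatrix_eq_zero_of hy (fun d => ?_) b
  rcases i with a | α
  · have hac : a ≠ c := fun h => hi (h ▸ rfl)
    -- For d = a, λ^a does not depend on q^a. For d ≠ a, ∂_a(λ_b^d σ_d) = (λ_b^a − λ_b^d) ρ σ_d +
    -- λ_b^d ρ σ_d = ρ σ_d λ_b^a.
    have hcol : ∃ w, ∀ b, pd (.inl a) (fun z => colMatrix g Λ N z b d) y
        = colMatrix g Λ N y b a * w := by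
      have h0 := H.scale_ne_zero hy a
      by_cases had : a = d
      · subst had
        refine ⟨pd (.inl a) (scale g N a) y / scale g N a y, fun b => ?_⟩
        rw [H.pd_colMatrix hy, H.pd_Λ_self hy]
        simp only [colMatrix, Matrix.of_apply]
        field_simp
        ring
      · obtain ⟨ρ, hρ, hρ'⟩ := H.exists_log_derivative hy had
        refine ⟨ρ * scale g N d y / scale g N a y, fun b => ?_⟩
        rw [H.pd_colMatrix hy, hρ', H.pd_scale hy hρ]
        simp only [colMatrix, Matrix.of_apply]
        field_simp
        ring
    obtain ⟨w, hw⟩ := hcol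
    simp only [hw, ← mul_assoc, ← Finset.sum_mul, H.sum_inv_mul_col hy, if_neg hac.symm, zero_mul]
  · refine Finset.sum_eq_zero fun b _ => ?_
    rw [H.pd_colMatrix hy, H.pd_inr_Λ hy,
      H.pd_scale (ρ := 0) hy fun j => by rw [H.ign_g y hy, zero_mul]]
    simp

/-- A row and its scale have the same logarithmic derivative in directions other than q^c. The ratio
is therefore a function of q^c; it becomes θ for isotropic q^c. -/
theorem pd_direction (H : CoordAlgebra V g κ Λ N) (hy : y ∈ V) {i : Fin (k + 1) ⊕ Fin r}
    {c : Fin (k + 1)} (hi : i ≠ .inl c) (j : Fin (k + 1) ⊕ Fin r) :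
    pd i (fun z => g (.inl c) j z / scale g N c z) y = 0 := by
  have hρ : ∃ ρ : ℝ, ∀ j, pd i (g (.inl c) j) y = ρ * g (.inl c) j y := by
    rcases i with a | α
    · obtain ⟨ρ, hρ, -⟩ := H.exists_log_derivative hy (a := a) (c := c) (fun h => hi (h ▸ rfl))
      exact ⟨ρ, hρ⟩
    · exact ⟨0, fun j => by rw [H.ign_g y hy, zero_mul]⟩
  obtain ⟨ρ, hρ⟩ := hρ
  have hd := differentiableAt_of_smoothOn H.isOpen (H.smooth_scale c) hy
  have hq : DifferentiableAt ℝ (fun z => g (.inl c) j z / scale g N c z) y :=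
    differentiableAt_of_smoothOn H.isOpen ((H.smooth_g (.inl c) j).div (H.smooth_scale c)
      fun z hz => H.scale_ne_zero hz c) hy
  have h1 := pd_congr (i := i) (f := g (.inl c) j)
    (g := fun z => g (.inl c) j z / scale g N c z * scale g N c z) H.isOpen
    (fun z hz => (div_mul_cancel₀ _ (H.scale_ne_zero hz c)).symm) hy
  rw [pd_mul hq hd, hρ, H.pd_scale hy hρ] at h1
  refine (mul_eq_zero.1 (?_ : _ * scale g N c y = 0)).resolve_right (H.scale_ne_zero hy c)
  have h2 := H.scale_ne_zero hy c
  have h3 : g (.inl c) j y / scale g N c y * (ρ * scale g N c y) = ρ * g (.inl c) j y := by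
    field_simp
  linarith

/-- The one-form `K_b · dg^{αβ}`. -/
def blockForm (g : Fin (k + 1) ⊕ Fin r → Fin (k + 1) ⊕ Fin r → Coord k r → ℝ)
    (Λ : Coord k r → Matrix (Fin (k + 1)) (Fin (k + 1)) ℝ) (b : Fin (k + 1)) (α β : Fin r)
    (i : Fin (k + 1) ⊕ Fin r) (y : Coord k r) : ℝ :=
  i.elim (fun a => Λ y b a * pd (.inl a) (g (.inr α) (.inr β)) y) (fun _ => 0)

/-- For K_m = G the potential must be g^{αβ} itself, with no additive constant, since it has to be
reproduced exactly. Otherwise K_b^{αβ} serves when at most one coordinate is isotropic, and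
closedness gives a primitive in the remaining case. -/
theorem exists_potential (H : CoordAlgebra V g κ Λ N)
    (hcl : ¬ N.Subsingleton → ∀ b α β, ∀ y ∈ V, ∀ i j,
      pd i (blockForm g Λ b α β j) y = pd j (blockForm g Λ b α β i) y)
    (b : Fin (k + 1)) (α β : Fin r) :
    ∃ W : Coord k r → ℝ, ContDiffOn ℝ ∞ W V ∧
      (∀ y ∈ V, ∀ i, pd i W y = blockForm g Λ b α β i y) ∧
      (b = Fin.last k → W = g (.inr α) (.inr β)) := by
  by_cases hb : b = Fin.last k
  · subst hb
    refine ⟨_, H.smooth_g _ _, fun y hy i => ?_, fun _ => rfl⟩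
    rcases i with a | γ
    · simp [blockForm, H.last y hy]
    · simp [blockForm, H.ign_g y hy]
  · by_cases hN : N.Subsingleton
    · refine ⟨κ b (.inr α) (.inr β), H.smooth_κ _ _ _, fun y hy i => ?_, fun h => absurd h hb⟩
      rcases i with a | γ
      · simp [blockForm, H.killing_block hN hy]
      · simp [blockForm, H.ign_κ y hy]
    · obtain ⟨W, hW, hW'⟩ := exists_primitive H.isOpen H.convex (om := blockForm g Λ b α β) (by
        intro i
        rcases i with a | γ
        · exact (H.smooth_Λ b a).mul (smoothOn_pd H.isOpen (H.smooth_g _ _))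
        · exact contDiffOn_const) (hcl hN b α β)
      exact ⟨W, hW, hW', fun h => absurd h hb⟩

theorem exists_stackel (H : CoordAlgebra V g κ Λ N)
    (hcl : ¬ N.Subsingleton → ∀ b α β, ∀ y ∈ V, ∀ i j,
      pd i (blockForm g Λ b α β j) y = pd j (blockForm g Λ b α β i) y) :
    ∃ (S : Fin (k + 1) → Fin (k + 1) → ℝ → ℝ) (θ : Fin (k + 1) → Fin r → ℝ → ℝ)
      (η : Fin (k + 1) → Fin r → Fin r → ℝ → ℝ),
      StackelForm V g κ Λ N S θ η := by
  have hS := fun a b => exists_eq_comp_eval (i := .inl a) H.isOpen H.convex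
    (H.smooth_invMatrix a b) (fun j hj z hz => H.pd_invMatrix hz hj b)
  choose S hS hS' using hS
  have hθ := fun a β => exists_eq_comp_eval (i := .inl a) H.isOpen H.convex
    ((H.smooth_g (.inl a) (.inr β)).div (H.smooth_scale a) fun y hy => H.scale_ne_zero hy a)
    (fun j hj z hz => H.pd_direction hz hj (.inr β))
  choose θ hθ hθ' using hθ
  choose W hW hW' hWl using H.exists_potential hcl
  -- The functions η are the components of S W. For c ≠ a, ∂_c of the a-th one is Σ_b S_ab λ_b^c ∂_c
  -- g^{αβ}, which vanishes because S P = 1 and σ_c ≠ 0.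
  have hηs : ∀ a α β, ContDiffOn ℝ ∞ (fun y => ∑ b, invMatrix g Λ N y a b * W b α β y) V :=
    fun a α β => ContDiffOn.sum fun b _ => (H.smooth_invMatrix a b).mul (hW b α β)
  have hη := fun a α β => exists_eq_comp_eval (i := .inl a) H.isOpen H.convex (hηs a α β)
    (fun j hj z hz => by
      have hd : ∀ b, DifferentiableAt ℝ (fun y => invMatrix g Λ N y a b) z := fun b =>
        differentiableAt_of_smoothOn H.isOpen (H.smooth_invMatrix a b) hz
      have hd' : ∀ b, DifferentiableAt ℝ (W b α β) z := fun b =>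
        differentiableAt_of_smoothOn H.isOpen (hW b α β) hz
      rw [pd_sum _ fun b _ => (hd b).fun_mul (hd' b)]
      simp only [pd_mul (hd _) (hd' _), H.pd_invMatrix hz hj, zero_mul, zero_add, hW' _ _ _ z hz]
      rcases j with c | γ
      · have hac : a ≠ c := fun h => hj (h ▸ rfl)
        have h1 := H.sum_inv_mul_col hz a c
        rw [if_neg hac] at h1
        simp only [colMatrix, Matrix.of_apply, ← mul_assoc, ← Finset.sum_mul] at h1
        have h2 := (mul_eq_zero.1 h1).resolve_right (H.scale_ne_zero hz c)
        simp only [blockForm, Sum.elim_inl, ← mul_assoc, ← Finset.sum_mul, h2, zero_mul]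
      · simp [blockForm])
  choose η hη hη' using hη
  have hM : ∀ y ∈ V, stackelMatrix S y = invMatrix g Λ N y := by
    intro y hy
    ext a b
    exact (hS' a b y hy).symm
  have hphi : ∀ y ∈ V, ∀ b a, phi S b a y = Λ y b a * scale g N a y := by
    intro y hy b a
    rw [phi, hM y hy, invMatrix, Matrix.nonsing_inv_nonsing_inv _ (H.det_colMatrix hy).isUnit]
    rfl
  refine ⟨S, θ, η, hS, hθ, hη, ?_, ?_, ?_, ?_, ?_, ?_⟩
  · intro y hy
    rw [hM y hy]
    exact (Matrix.isUnit_nonsing_inv_det _ (H.det_colMatrix hy).isUnit).ne_zero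
  · intro y hy a
    rw [hphi y hy, H.last y hy, one_mul]
    exact H.scale_ne_zero hy a
  · intro y hy b a
    rw [hphi y hy, hphi y hy, H.last y hy, one_mul]
  · intro y hy b a ha
    rw [hphi y hy, H.eigen y hy]
    simp [scale, ha]
  · intro y hy b a ha β
    rw [hphi y hy, H.eigen y hy, ← hθ' a β y hy]
    have := H.scale_ne_zero hy a
    simp only [Pi.div_apply]
    field_simp
  · intro y hy α β
    simp only [hphi y hy, H.last y hy, one_mul, ← hη' _ α β y hy]
    -- The last row of P S W = W is the formula for g^{αβ}: the last row of P is (σ_a), and W_m =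
    -- g^{αβ}.
    have h1 : Matrix.mulVec (colMatrix g Λ N y)
        (Matrix.mulVec (invMatrix g Λ N y) (fun b => W b α β y)) (Fin.last k)
        = W (Fin.last k) α β y := by
      rw [Matrix.mulVec_mulVec, invMatrix, Matrix.mul_nonsing_inv _ (H.det_colMatrix hy).isUnit,
        Matrix.one_mulVec]
    rw [hWl _ α β rfl] at h1
    rw [← h1]
    simp only [Matrix.mulVec, dotProduct, colMatrix, Matrix.of_apply, H.last y hy, one_mul]
    exact Finset.sum_congr rfl fun a _ => mul_comm _ _

end CoordAlgebra

/-! ### Coordinate differentials and frames of a chart -/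

section Charts

variable {k r : ℕ} {Q : Type*} [TopologicalSpace Q] [ChartedSpace (Coord k r) Q]
  {e : OpenPartialHomeomorph Q (Coord k r)} {x : Q}

theorem mdifferentiableAt_coord (he : e ∈ IsManifold.maximalAtlas (Mdl k r) ∞ Q)
    [IsManifold (Mdl k r) ∞ Q] (hx : x ∈ e.source) (i : Fin (k + 1) ⊕ Fin r) :
    MDifferentiableAt (Mdl k r) 𝓘(ℝ, ℝ) (fun y => e y i) x := by
  have he1 : e ∈ IsManifold.maximalAtlas (Mdl k r) 1 Q :=
    IsManifold.maximalAtlas_subset_of_le (by simp) he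
  have : IsManifold (Mdl k r) 1 Q := IsManifold.of_le (n := ∞) (by simp)
  have h1 : MDifferentiableAt (Mdl k r) 𝓘(ℝ, Coord k r) e x :=
    mdifferentiableAt_of_mem_maximalAtlas he1 hx
  have h2 : MDifferentiableAt 𝓘(ℝ, Coord k r) 𝓘(ℝ, ℝ)
      (ContinuousLinearMap.proj (R := ℝ) (φ := fun _ : Fin (k + 1) ⊕ Fin r => ℝ) i) (e x) :=
    ContinuousLinearMap.mdifferentiableAt _
  exact h2.comp x h1

theorem dq_apply (he : e ∈ IsManifold.maximalAtlas (Mdl k r) ∞ Q)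
    [IsManifold (Mdl k r) ∞ Q] (hx : x ∈ e.source) (i : Fin (k + 1) ⊕ Fin r)
    (v : TangentSpace (Mdl k r) x) :
    dq e i x v = (mfderiv (Mdl k r) 𝓘(ℝ, Coord k r) e x v : Coord k r) i := by
  have he1 : e ∈ IsManifold.maximalAtlas (Mdl k r) 1 Q :=
    IsManifold.maximalAtlas_subset_of_le (by simp) he
  have : IsManifold (Mdl k r) 1 Q := IsManifold.of_le (n := ∞) (by simp)
  have h1 : MDifferentiableAt (Mdl k r) 𝓘(ℝ, Coord k r) e x :=
    mdifferentiableAt_of_mem_maximalAtlas he1 hx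
  have h2 := (ContinuousLinearMap.proj (R := ℝ) (φ := fun _ : Fin (k + 1) ⊕ Fin r => ℝ)
    i).hasMFDerivAt (x := e x)
  have h3 := (h2.comp x h1.hasMFDerivAt).mfderiv
  exact congrArg (fun L => L v) h3

theorem exists_frame (he : e ∈ IsManifold.maximalAtlas (Mdl k r) ∞ Q)
    [IsManifold (Mdl k r) ∞ Q] (hx : x ∈ e.source) :
    ∃ v : Fin (k + 1) ⊕ Fin r → TangentSpace (Mdl k r) x,
      (∀ i j, dq e i x (v j) = if i = j then 1 else 0) ∧
      ∀ w, w = ∑ j, dq e j x w • v j := by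
  have he1 : e ∈ IsManifold.maximalAtlas (Mdl k r) 1 Q :=
    IsManifold.maximalAtlas_subset_of_le (by simp) he
  have : IsManifold (Mdl k r) 1 Q := IsManifold.of_le (n := ∞) (by simp)
  have hmd : e.MDifferentiable (Mdl k r) (Mdl k r) :=
    ⟨fun y hy => (mdifferentiableAt_of_mem_maximalAtlas he1 hy).mdifferentiableWithinAt,
      fun y hy => (mdifferentiableAt_symm_of_mem_maximalAtlas he1 hy).mdifferentiableWithinAt⟩
  let A : TangentSpace (Mdl k r) x ≃L[ℝ] Coord k r := hmd.mfderiv hx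
  have hA : ∀ w i, dq e i x w = A w i := fun w i => dq_apply he hx i w
  refine ⟨fun j => A.symm (Pi.single j 1), fun i j => ?_, fun w => ?_⟩
  · rw [hA, A.apply_symm_apply, Pi.single_apply]
  · apply A.injective
    funext i
    simp [hA, Finset.sum_apply, Pi.single_apply, -Fintype.sum_sum_type]

theorem cot_eq_sum {v : Fin (k + 1) ⊕ Fin r → TangentSpace (Mdl k r) x}
    (hv : ∀ w, w = ∑ j, dq e j x w • v j) (ζ : Cot k r Q x) :
    ζ = ∑ j, ζ (v j) • dq e j x := by
  ext w
  conv_lhs => rw [hv w]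
  simp [mul_comm, -Fintype.sum_sum_type]

end Charts

/-! ### Eigenvalues, orthogonality and null directions on the manifold -/

section Algebra

variable {k r m₀ : ℕ} {Q : Type*} [TopologicalSpace Q] [ChartedSpace (Coord k r) Q]
  {G : Tensor2 k r Q} {D : Submodule ℝ (VF k r Q)} {𝒦 : Submodule ℝ (Tensor2 k r Q)}
  {ξ : Fin (k + 1) → OneForm k r Q} {e : OpenPartialHomeomorph Q (Coord k r)} {x : Q}

/-- A chart of the maximal atlas whose coordinates `q^a` are orthogonal to the `E_a` and whose
coordinate fields `∂_α` form a basis of `D`. -/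
structure IsCompatibleChart (D : Submodule ℝ (VF k r Q)) (ξ : Fin (k + 1) → OneForm k r Q)
    (e : OpenPartialHomeomorph Q (Coord k r)) : Prop where
  mem_atlas : e ∈ IsManifold.maximalAtlas (Mdl k r) ∞ Q
  essential : ∀ a, ∀ x ∈ e.source, ∃ c : ℝ, dq e (Sum.inl a) x = c • ξ a x
  ignorable : ∃ X : Module.Basis (Fin r) ℝ D, ∀ α, ∀ x ∈ e.source, ∀ i,
    dq e i x ((X α : VF k r Q) x) = if i = Sum.inr α then 1 else 0

theorem IsAdapted.isCompatibleChart (h : IsAdapted G D 𝒦 ξ m₀ e) : IsCompatibleChart D ξ e :=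
  ⟨h.mem_atlas, h.essential, h.ignorable⟩

theorem IsMetric.exists_apply_ne_zero (hG : IsMetric G) {ζ : Cot k r Q x} (h : ζ ≠ 0) :
    ∃ η, G x ζ η ≠ 0 := by
  by_contra! h'
  exact h (hG.nondeg x ζ h')

theorem IsCompatibleChart.dq_apply_eq_zero (hP : IsCompatibleChart D ξ e)
    (hA : IsSeparableKillingAlgebra G D 𝒦 ξ m₀) (hx : x ∈ e.source) (a : Fin (k + 1))
    {X : VF k r Q} (hX : X ∈ D) : dq e (.inl a) x (X x) = 0 := by
  obtain ⟨c, hc⟩ := hP.essential a x hx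
  rw [hc]
  change c • ξ a x (X x) = 0
  rw [hA.orth_ξ a x X hX, smul_zero]

theorem IsCompatibleChart.eigen (hP : IsCompatibleChart D ξ e) (hx : x ∈ e.source) {K : Tensor2 k r Q}
    {a : Fin (k + 1)} {c : ℝ} (h : ∀ η, K x (ξ a x) η = c * G x (ξ a x) η) (η : Cot k r Q x) :
    K x (dq e (.inl a) x) η = c * G x (dq e (.inl a) x) η := by
  obtain ⟨t, ht⟩ := hP.essential a x hx
  rw [ht]
  simp only [map_smul, LinearMap.smul_apply, smul_eq_mul, h]
  ring

theorem IsCompatibleChart.pd_comp (hP : IsCompatibleChart D ξ e) {T : Tensor2 k r Q}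
    (hT : ∀ X ∈ D, LieInvariant X T) {y : Coord k r} (hy : y ∈ e.target) (α : Fin r)
    (i j : Fin (k + 1) ⊕ Fin r) : pd (.inr α) (comp T e i j) y = 0 := by
  obtain ⟨X, hX⟩ := hP.ignorable
  have hv : ∀ l, ∀ z ∈ e.target, vcomp (X α : VF k r Q) e l z
      = if l = .inr α then 1 else 0 := fun l z hz => hX α _ (e.map_target hz) l
  have hv' : ∀ l i, pd l (vcomp (X α : VF k r Q) e i) y = 0 := fun l i =>
    pd_eq_zero_of_eq_const e.open_target (hv i) hy
  have := hT _ (X α).2 e hP.mem_atlas y hy i j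
  simpa [hv _ y hy, hv', -Fintype.sum_sum_type] using this

variable {K : Module.Basis (Fin (k + 1)) ℝ 𝒦} {Λ : Q → Matrix (Fin (k + 1)) (Fin (k + 1)) ℝ}

theorem eigenvalue_last (hG : IsMetric G) (hA : IsSeparableKillingAlgebra G D 𝒦 ξ m₀)
    (hK : (K (Fin.last k) : Tensor2 k r Q) = G)
    (hΛ : IsEigenvalueMatrix G (fun i => (K i : Tensor2 k r Q)) ξ Λ) (x : Q) (a : Fin (k + 1)) :
    Λ x (Fin.last k) a = 1 := by
  obtain ⟨η, hη⟩ := hG.exists_apply_ne_zero ((hA.indep_ξ x).ne_zero a)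
  have := hΛ x (Fin.last k) a η
  simp only [hK] at this
  exact (mul_right_cancel₀ hη (by rw [one_mul, ← this])).symm

/-- Evaluation of tensor fields. -/
def evalTensor (𝒦 : Submodule ℝ (Tensor2 k r Q)) (x : Q) (ζ η : Cot k r Q x) : 𝒦 →ₗ[ℝ] ℝ where
  toFun T := (T : Tensor2 k r Q) x ζ η
  map_add' _ _ := rfl
  map_smul' _ _ := rfl

/-- A linear relation among the rows at `x` gives an element of `𝒦` that annihilates every E_a at
`x`. It is zero by (b), against the independence of the basis. -/
theorem det_eigenvalues_ne_zero (hA : IsSeparableKillingAlgebra G D 𝒦 ξ m₀)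
    (hΛ : IsEigenvalueMatrix G (fun i => (K i : Tensor2 k r Q)) ξ Λ) (x : Q) :
    (Λ x).det ≠ 0 := by
  intro h
  obtain ⟨s, hs, hs'⟩ := Matrix.exists_vecMul_eq_zero_iff.2 h
  set T : 𝒦 := K.equivFun.symm s with hT
  have h1 : (T : Tensor2 k r Q) = 0 := by
    refine hA.indep_𝒦 _ T.2 x fun a η => ?_
    change evalTensor 𝒦 x (ξ a x) η T = 0
    have h3 : ∀ b, evalTensor 𝒦 x (ξ a x) η (K b) = Λ x b a * G x (ξ a x) η :=
      fun b => hΛ x b a η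
    rw [hT, Module.Basis.equivFun_symm_apply, map_sum]
    simp only [map_smul, smul_eq_mul, h3, ← mul_assoc, ← Finset.sum_mul]
    have h4 : ∑ b, s b * Λ x b a = 0 := congrFun hs' a
    rw [h4, zero_mul]
  have h2 : T = 0 := Subtype.ext h1
  exact hs (K.equivFun.symm.map_eq_zero_iff.1 h2)

/-- If g^{ac} ≠ 0, symmetry of each K_b forces λ_b^a = λ_b^c, so that Λ would have two equal
columns. -/
theorem IsCompatibleChart.orth (hP : IsCompatibleChart D ξ e) (hG : IsMetric G)
    (hA : IsSeparableKillingAlgebra G D 𝒦 ξ m₀)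
    (hΛ : IsEigenvalueMatrix G (fun i => (K i : Tensor2 k r Q)) ξ Λ) (hx : x ∈ e.source)
    {a c : Fin (k + 1)} (hac : a ≠ c) : G x (dq e (.inl a) x) (dq e (.inl c) x) = 0 := by
  by_contra h
  refine det_eigenvalues_ne_zero hA hΛ x (Matrix.det_zero_of_column_eq hac fun b => ?_)
  have h1 := hP.eigen hx (fun η => hΛ x b a η) (dq e (.inl c) x)
  have h2 := hP.eigen hx (fun η => hΛ x b c η) (dq e (.inl a) x)
  rw [(hA.killing_𝒦 _ (K b).2).symm, h1, hG.symm x (dq e (.inl c) x)] at h2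
  exact mul_right_cancel₀ h h2

variable [IsManifold (Mdl k r) ∞ Q]

theorem linearIndependent_dq (he : e ∈ IsManifold.maximalAtlas (Mdl k r) ∞ Q)
    (hx : x ∈ e.source) : LinearIndependent ℝ (fun i => dq e i x) := by
  obtain ⟨v, hv, -⟩ := exists_frame he hx
  rw [Fintype.linearIndependent_iff]
  intro c hc j
  have := congrArg (fun ζ : Cot k r Q x => ζ (v j)) hc
  simpa [hv, -Fintype.sum_sum_type] using this

theorem dq_ne_zero (he : e ∈ IsManifold.maximalAtlas (Mdl k r) ∞ Q)
    (hx : x ∈ e.source) (i : Fin (k + 1) ⊕ Fin r) : dq e i x ≠ 0 :=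
  (linearIndependent_dq he hx).ne_zero i

theorem form_eq_zero_of_dq (he : e ∈ IsManifold.maximalAtlas (Mdl k r) ∞ Q)
    (hx : x ∈ e.source) (hG : IsMetric G) {ζ : Cot k r Q x} (h : ∀ i, G x ζ (dq e i x) = 0) :
    ζ = 0 := by
  obtain ⟨v, -, hv⟩ := exists_frame he hx
  refine hG.nondeg x ζ fun η => ?_
  rw [cot_eq_sum hv η]
  simp [h, -Fintype.sum_sum_type]

theorem linearIndependent_gram (he : e ∈ IsManifold.maximalAtlas (Mdl k r) ∞ Q)
    (hx : x ∈ e.source) (hG : IsMetric G) :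
    LinearIndependent ℝ (fun i j => G x (dq e i x) (dq e j x)) := by
  rw [Fintype.linearIndependent_iff]
  intro c hc
  have h1 : ∑ i, c i • dq e i x = 0 := by
    refine form_eq_zero_of_dq he hx hG fun j => ?_
    have := congrFun hc j
    simpa [Finset.sum_apply, LinearMap.sum_apply, -Fintype.sum_sum_type] using this
  exact Fintype.linearIndependent_iff.1 (linearIndependent_dq he hx) c h1

namespace IsCompatibleChart

theorem exists_smul (hP : IsCompatibleChart D ξ e) (hx : x ∈ e.source) (a : Fin (k + 1)) :
    ∃ c : ℝ, c ≠ 0 ∧ dq e (.inl a) x = c • ξ a x := by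
  obtain ⟨c, hc⟩ := hP.essential a x hx
  refine ⟨c, ?_, hc⟩
  rintro rfl
  exact dq_ne_zero hP.mem_atlas hx (.inl a) (by rw [hc, zero_smul])

theorem mem_dist_iff (hP : IsCompatibleChart D ξ e)
    (hA : IsSeparableKillingAlgebra G D 𝒦 ξ m₀) (hx : x ∈ e.source)
    (w : TangentSpace (Mdl k r) x) : w ∈ dist D x ↔ ∀ a, dq e (.inl a) x w = 0 := by
  constructor
  · rintro ⟨X, hX, rfl⟩ a
    exact hP.dq_apply_eq_zero hA hx a hX
  · intro h
    obtain ⟨v, hv, hv'⟩ := exists_frame hP.mem_atlas hx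
    obtain ⟨X, hX⟩ := hP.ignorable
    have h1 : ∀ α, (X α : VF k r Q) x = v (.inr α) := by
      intro α
      rw [hv' ((X α : VF k r Q) x)]
      simp [hX α x hx, -Fintype.sum_sum_type]
    rw [hv' w, Fintype.sum_sum_type]
    simp only [h, zero_smul, Finset.sum_const_zero, zero_add, ← h1]
    exact Submodule.sum_mem _ fun α _ => Submodule.smul_mem _ _ ⟨X α, (X α).2, rfl⟩

/-- The rank of `Δ ∩ Δ^⊥` is the number of null essential coordinates. -/
theorem ncard_null (hP : IsCompatibleChart D ξ e) (hG : IsMetric G)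
    (hA : IsSeparableKillingAlgebra G D 𝒦 ξ m₀) (hx : x ∈ e.source)
    (horth : ∀ a c, a ≠ c → G x (dq e (.inl a) x) (dq e (.inl c) x) = 0) :
    {a | G x (dq e (.inl a) x) (dq e (.inl a) x) = 0}.ncard = m₀ := by
  classical
  set Z : Set (Fin (k + 1)) := {a | G x (dq e (.inl a) x) (dq e (.inl a) x) = 0} with hZ
  obtain ⟨v, hv, hv'⟩ := exists_frame hP.mem_atlas hx
  -- The metric duals of the null dq^a; they turn out to be a basis of Δ ∩ Δ^⊥.
  let E : Z → TangentSpace (Mdl k r) x := fun a =>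
    ∑ j, G x (dq e (.inl a) x) (dq e j x) • v j
  have hE : ∀ a, ∀ η : Cot k r Q x, η (E a) = G x (dq e (.inl a) x) η := by
    intro a η
    conv_rhs => rw [cot_eq_sum hv' η]
    simp [E, mul_comm, -Fintype.sum_sum_type]
  have hli : LinearIndependent ℝ E := by
    rw [Fintype.linearIndependent_iff]
    intro c hc
    have h1 : ∑ a : Z, c a • dq e (.inl (a : Fin (k + 1))) x = 0 := by
      refine hG.nondeg x _ fun η => ?_
      have := congrArg η hc
      simpa [hE, LinearMap.sum_apply] using this
    have h2 := (linearIndependent_dq hP.mem_atlas hx).comp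
      (fun a : Z => (Sum.inl (a : Fin (k + 1)) : Fin (k + 1) ⊕ Fin r))
      (Sum.inl_injective.comp Subtype.val_injective)
    exact Fintype.linearIndependent_iff.1 h2 c h1
  have hspan : Submodule.span ℝ (Set.range E) = dist D x ⊓ distPerp G D x := by
    apply le_antisymm
    · rw [Submodule.span_le]
      rintro _ ⟨a, rfl⟩
      refine ⟨(hP.mem_dist_iff hA hx _).2 fun c => ?_, dq e (.inl a) x, fun η => (hE a η).symm,
        fun X hX => hP.dq_apply_eq_zero hA hx a hX⟩
      rw [hE]
      by_cases hac : (a : Fin (k + 1)) = c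
      · rw [← hac]
        exact a.2
      · exact horth _ _ hac
    -- The dual form ζ of w annihilates Δ, so it is a combination of the dq^a. As w lies in Δ, the
    -- coefficient at c times g^{cc} is zero, and only null indices survive.
    · rintro w ⟨hw, ζ, hζ, hζD⟩
      have hw' := (hP.mem_dist_iff hA hx w).1 hw
      have hζv : ∀ α, ζ (v (.inr α)) = 0 := by
        intro α
        have h1 : v (.inr α) ∈ dist D x :=
          (hP.mem_dist_iff hA hx _).2 fun a => by simp [hv]
        obtain ⟨X, hX, hXv⟩ := h1
        rw [← hXv]
        exact hζD X hX
      have hζ' : ζ = ∑ a, ζ (v (.inl a)) • dq e (.inl a) x := by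
        conv_lhs => rw [cot_eq_sum hv' ζ, Fintype.sum_sum_type]
        simp [hζv]
      have hz : ∀ c, c ∉ Z → ζ (v (.inl c)) = 0 := by
        intro c hc
        have h1 : G x ζ (dq e (.inl c) x) = 0 := by rw [hζ, hw']
        rw [hζ'] at h1
        simp only [map_sum, map_smul, LinearMap.sum_apply, LinearMap.smul_apply,
          smul_eq_mul] at h1
        rw [Finset.sum_eq_single c (fun a _ hac => by rw [horth a c hac, mul_zero]) (by simp)] at h1
        exact (mul_eq_zero.1 h1).resolve_right hc
      have hsum : ∀ f : Fin (k + 1) → ℝ, (∀ a ∉ Z, f a = 0) → ∑ a, f a = ∑ a : Z, f a := by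
        intro f hf
        rw [← Finset.sum_subtype (Finset.univ.filter (· ∈ Z)) (by simp) f]
        exact (Finset.sum_subset (Finset.filter_subset _ _) fun a _ ha => hf a (by
          simpa using ha)).symm
      have hwE : w = ∑ a : Z, ζ (v (.inl (a : Fin (k + 1)))) • E a := by
        have h1 : ∀ j, dq e j x w
            = dq e j x (∑ a : Z, ζ (v (.inl (a : Fin (k + 1)))) • E a) := by
          intro j
          rw [← hζ, hζ']
          simp only [map_sum, map_smul, LinearMap.sum_apply, LinearMap.smul_apply, smul_eq_mul, hE]
          rw [← hζ']
          exact hsum _ fun a ha => by rw [hz a ha, zero_mul]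
        rw [hv' w, hv' (∑ a : Z, ζ (v (.inl (a : Fin (k + 1)))) • E a)]
        simp only [h1]
      rw [hwE]
      exact Submodule.sum_mem _ fun a _ => Submodule.smul_mem _ _ (Submodule.subset_span ⟨a, rfl⟩)
  rw [← hA.rank_null x, ← hspan, finrank_span_eq_card hli, Set.ncard_eq_toFinset_card',
    Set.toFinset_card]

end IsCompatibleChart

end Algebra

/-! ### Stäckel form of adapted coordinates on convex sets -/

section LocalForm

variable {k r m₀ : ℕ} {Q : Type*} [TopologicalSpace Q] [ChartedSpace (Coord k r) Q]
  {G : Tensor2 k r Q} {D : Submodule ℝ (VF k r Q)} {𝒦 : Submodule ℝ (Tensor2 k r Q)}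
  {ξ : Fin (k + 1) → OneForm k r Q} {e : OpenPartialHomeomorph Q (Coord k r)}
  {K : Module.Basis (Fin (k + 1)) ℝ 𝒦} {Λ : Q → Matrix (Fin (k + 1)) (Fin (k + 1)) ℝ}
  {V : Set (Coord k r)} {N : Set (Fin (k + 1))}

theorem comp_eigen (hP : IsCompatibleChart D ξ e)
    (hΛ : IsEigenvalueMatrix G (fun i => (K i : Tensor2 k r Q)) ξ Λ) {y : Coord k r}
    (hy : y ∈ e.target) (b a : Fin (k + 1)) (j : Fin (k + 1) ⊕ Fin r) :
    comp (K b : Tensor2 k r Q) e (.inl a) j y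
      = Λ (e.symm y) b a * comp G e (.inl a) j y :=
  hP.eigen (e.map_target hy) (fun η => hΛ _ b a η) _

variable [IsManifold (Mdl k r) ∞ Q]

/-- Nonvanishing of g^{aa} is an open condition, so the null set can only shrink nearby. Its
cardinality is always m₀, hence it is locally constant, and constant on a preconnected set. -/
theorem exists_null_set (hP : IsCompatibleChart D ξ e) (hG : IsMetric G)
    (hA : IsSeparableKillingAlgebra G D 𝒦 ξ m₀)
    (hΛ : IsEigenvalueMatrix G (fun i => (K i : Tensor2 k r Q)) ξ Λ)
    (hV : IsPreconnected V) (hVe : V ⊆ e.target) :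
    ∃ N : Set (Fin (k + 1)), (∀ y ∈ V, ∀ a, a ∈ N ↔ comp G e (.inl a) (.inl a) y = 0) ∧
      (¬ N.Subsingleton → 1 < m₀) := by
  classical
  rcases V.eq_empty_or_nonempty with rfl | ⟨y₀, hy₀⟩
  · exact ⟨∅, by simp, fun h => absurd Set.subsingleton_empty h⟩
  let Z : Coord k r → Set (Fin (k + 1)) := fun y => {a | comp G e (.inl a) (.inl a) y = 0}
  have hcard : ∀ y ∈ V, (Z y).ncard = m₀ := fun y hy =>
    hP.ncard_null hG hA (e.map_target (hVe hy))
      fun a c hac => hP.orth hG hA hΛ (e.map_target (hVe hy)) hac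
  let f : Coord k r → Fin (k + 1) → Bool := fun y a => decide (a ∈ Z y)
  have hcont : ContinuousOn f V := by
    intro y hy
    have hnear : ∀ᶠ z in 𝓝[V] y, Z z ⊆ Z y := by
      have h1 : ∀ a, ∀ᶠ z in 𝓝[V] y, a ∈ Z z → a ∈ Z y := by
        intro a
        by_cases ha : a ∈ Z y
        · exact Filter.Eventually.of_forall fun _ _ => ha
        · have hc := ((hG.smooth e hP.mem_atlas (.inl a) (.inl a)).continuousOn.mono hVe) y hy
          filter_upwards [hc.eventually_ne ha] with z hz h
          exact absurd h hz
      filter_upwards [Filter.eventually_all.2 h1] with z hz a ha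
      exact hz a ha
    have heq : f =ᶠ[𝓝[V] y] fun _ => f y := by
      filter_upwards [hnear, self_mem_nhdsWithin] with z hz hzV
      have := Set.eq_of_subset_of_ncard_le hz (by rw [hcard z hzV, hcard y hy])
      simp only [f, this]
    exact continuousWithinAt_const.congr_of_eventuallyEq heq rfl
  refine ⟨Z y₀, fun y hy a => ?_, fun h => ?_⟩
  · have h1 := congrFun (hV.constant hcont hy hy₀) a
    have h2 : a ∈ Z y ↔ a ∈ Z y₀ := by simpa [f] using h1
    exact h2.symm
  · rw [← hcard y₀ hy₀]
    rw [Set.not_subsingleton_iff] at h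
    exact Set.one_lt_ncard_iff_nontrivial.2 h

theorem coordAlgebra (hP : IsAdapted G D 𝒦 ξ m₀ e) (hG : IsMetric G)
    (hA : IsSeparableKillingAlgebra G D 𝒦 ξ m₀)
    (hK : (K (Fin.last k) : Tensor2 k r Q) = G)
    (hΛ : IsEigenvalueMatrix G (fun i => (K i : Tensor2 k r Q)) ξ Λ)
    (hVo : IsOpen V) (hVc : Convex ℝ V) (hVe : V ⊆ e.target)
    (hN : ∀ y ∈ V, ∀ a, a ∈ N ↔ comp G e (.inl a) (.inl a) y = 0) :
    CoordAlgebra V (comp G e) (fun b => comp (K b : Tensor2 k r Q) e)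
      (fun y => Λ (e.symm y)) N where
  isOpen := hVo
  convex := hVc
  smooth_g i j := (hG.smooth e hP.mem_atlas i j).mono hVe
  smooth_κ b i j := ((hA.killing_𝒦 _ (K b).2).smooth e hP.mem_atlas i j).mono hVe
  symm_g y _ i j := hG.symm _ _ _
  symm_κ y _ b i j := (hA.killing_𝒦 _ (K b).2).symm _ _ _
  ign_g y hy α i j := hP.isCompatibleChart.pd_comp (fun X hX => hA.killing_D X hX) (hVe hy) α i j
  ign_κ y hy b α i j :=
    hP.isCompatibleChart.pd_comp (fun X hX => hA.invariant X hX _ (K b).2) (hVe hy) α i j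
  eigen y hy b a j := comp_eigen hP.isCompatibleChart hΛ (hVe hy) b a j
  orth y hy a c hac := hP.isCompatibleChart.orth hG hA hΛ (e.map_target (hVe hy)) hac
  null y hy a ha := (hN y hy a).1 ha
  nonnull y hy a ha h := ha ((hN y hy a).2 h)
  origin y hy a ha β := by
    have hx := e.map_target (hVe hy)
    refine hP.origin a β _ hx fun h => ha ((hN y hy a).2 ?_)
    obtain ⟨c, -, hc⟩ := hP.isCompatibleChart.exists_smul hx a
    simp only [comp, hc, map_smul, LinearMap.smul_apply, h, smul_zero]
  indep y hy := (linearIndependent_gram hP.mem_atlas (e.map_target (hVe hy)) hG).comp _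
    Sum.inl_injective
  det y _ := det_eigenvalues_ne_zero hA hΛ _
  last y _ a := eigenvalue_last hG hA hK hΛ _ a
  bracket y hy b i j h := (hA.killing_𝒦 _ (K b).2).bracket e hP.mem_atlas y (hVe hy) i j h

/-- By the eigenvalue equations the matrix of G maps the block form to K_b dg^{αβ}, and the matrix
of G is invertible. -/
theorem tensorD_eq_blockForm (hP : IsAdapted G D 𝒦 ξ m₀ e) (hG : IsMetric G)
    (H : CoordAlgebra V (comp G e) (fun b => comp (K b : Tensor2 k r Q) e)
      (fun y => Λ (e.symm y)) N) (hVe : V ⊆ e.target) {y : Coord k r} (hy : y ∈ V)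
    (b : Fin (k + 1)) (α β : Fin r) (i : Fin (k + 1) ⊕ Fin r) :
    tensorD G (K b : Tensor2 k r Q) e (comp G e (.inr α) (.inr β)) i y
      = CoordAlgebra.blockForm (comp G e) (fun y => Λ (e.symm y)) b α β i y := by
  set A : Matrix (Fin (k + 1) ⊕ Fin r) (Fin (k + 1) ⊕ Fin r) ℝ :=
    Matrix.of fun s t => comp G e s t y with hA
  have hdet : IsUnit A.det := by
    rw [← Matrix.isUnit_iff_isUnit_det]
    exact Matrix.linearIndependent_rows_iff_isUnit.1
      (linearIndependent_gram hP.mem_atlas (e.map_target (hVe hy)) hG)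
  have h1 : (Matrix.of fun s t => comp (K b : Tensor2 k r Q) e s t y).mulVec
      (fun h => pd h (comp G e (.inr α) (.inr β)) y)
      = A.mulVec (fun i => CoordAlgebra.blockForm (comp G e) (fun y => Λ (e.symm y)) b α β i y) := by
    funext s
    simp only [Matrix.mulVec, dotProduct, Fintype.sum_sum_type, Matrix.of_apply, hA,
      H.ign_g y hy, mul_zero, Finset.sum_const_zero, add_zero, CoordAlgebra.blockForm,
      Sum.elim_inl, Sum.elim_inr]
    refine Finset.sum_congr rfl fun a _ => ?_
    rw [H.symm_κ y hy b s (.inl a), H.eigen y hy, H.symm_g y hy s (.inl a)]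
    ring
  simp only [tensorD]
  rw [← Matrix.mulVec_mulVec, h1, Matrix.mulVec_mulVec, Matrix.nonsing_inv_mul _ hdet,
    Matrix.one_mulVec]

/-- On convex open sets of coordinate values, adapted coordinates are of Stäckel form. -/
theorem exists_stackelForm (hP : IsAdapted G D 𝒦 ξ m₀ e) (hG : IsMetric G)
    (hA : IsSeparableKillingAlgebra G D 𝒦 ξ m₀)
    (hK : (K (Fin.last k) : Tensor2 k r Q) = G)
    (hΛ : IsEigenvalueMatrix G (fun i => (K i : Tensor2 k r Q)) ξ Λ)
    (hVo : IsOpen V) (hVc : Convex ℝ V) (hVe : V ⊆ e.target) :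
    ∃ N, CoordAlgebra V (comp G e) (fun b => comp (K b : Tensor2 k r Q) e)
        (fun y => Λ (e.symm y)) N ∧
      ∃ S θ η, StackelForm V (comp G e) (fun b => comp (K b : Tensor2 k r Q) e)
        (fun y => Λ (e.symm y)) N S θ η := by
  obtain ⟨N, hN, hm⟩ :=
    exists_null_set hP.isCompatibleChart hG hA hΛ hVc.isPreconnected hVe
  have H := coordAlgebra hP hG hA hK hΛ hVo hVc hVe hN
  refine ⟨N, H, H.exists_stackel fun hs b α β y hy i j => ?_⟩
  rw [← pd_congr hVo (fun z hz => tensorD_eq_blockForm hP hG H hVe hz b α β j) hy,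
    ← pd_congr hVo (fun z hz => tensorD_eq_blockForm hP hG H hVe hz b α β i) hy]
  exact hP.closed (hm hs) _ (K b).2 α β y (hVe hy) i j

end LocalForm

/-! ### Minors of the eigenvalue matrix -/

section Minors

variable {k : ℕ}

/-- Here Λ⁻¹ = diag(n) S, and its entries are the signed minors of Λ divided by det Λ. -/
theorem minor_eq_of_inv {Λ S : Matrix (Fin (k + 1)) (Fin (k + 1)) ℝ} {n : Fin (k + 1) → ℝ}
    (hS : S.det ≠ 0) (h : ∀ b a, S⁻¹ b a = Λ b a * n a) (b a : Fin (k + 1)) :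
    Λ.det ≠ 0 ∧ minor Λ b a = (-1) ^ (b + a : ℕ) * (Λ.det * n a * S a b) := by
  have h1 : S⁻¹ = Λ * Matrix.diagonal n := by
    ext b a
    rw [h, Matrix.mul_diagonal]
  have hS' : IsUnit S.det := hS.isUnit
  have hdet : Λ.det ≠ 0 := by
    intro h0
    have := (Matrix.isUnit_nonsing_inv_det _ hS').ne_zero
    rw [h1, Matrix.det_mul, h0, zero_mul] at this
    exact this rfl
  refine ⟨hdet, ?_⟩
  have h2 : Λ * (Matrix.diagonal n * S) = 1 := by
    rw [← mul_assoc, ← h1, Matrix.nonsing_inv_mul _ hS']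
  have h3 : Λ⁻¹ = Matrix.diagonal n * S := Matrix.inv_eq_right_inv h2
  have h4 := congrFun (congrFun h3 a) b
  rw [Matrix.diagonal_mul, Matrix.inv_def, Matrix.smul_apply, Matrix.adjugate_fin_succ_eq_det_submatrix,
    Ring.inverse_eq_inv', smul_eq_mul] at h4
  change Λ.det⁻¹ * ((-1) ^ (b + a : ℕ) * minor Λ b a) = _ at h4
  have h5 : (-1 : ℝ) ^ (b + a : ℕ) * (-1) ^ (b + a : ℕ) = 1 := by
    rw [← mul_pow]
    simp
  rw [mul_assoc, ← h4, mul_inv_cancel_left₀ hdet, ← mul_assoc, h5, one_mul]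

end Minors

/-! ### Vectors of functions with constant ratios, and changes of variable -/

section OneVariable

variable {I : Set ℝ}

theorem differentiableAt_of_smoothOn_real (hI : IsOpen I) {f : ℝ → ℝ} (hf : ContDiffOn ℝ ∞ f I)
    {t : ℝ} (ht : t ∈ I) : DifferentiableAt ℝ f t :=
  (hf.contDiffAt (hI.mem_nhds ht)).differentiableAt (by simp)

/-- A vector of functions with constant ratios is the product of a function and a constant
vector. -/
theorem exists_eq_mul_of_deriv_div_eq_zero (hI : IsOpen I) (hc : Convex ℝ I) {ι : Type*}
    [Fintype ι] {S : ι → ℝ → ℝ} (hS : ∀ b, ContDiffOn ℝ ∞ (S b) I)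
    (h0 : ∀ t ∈ I, ∃ b, S b t ≠ 0)
    (h : ∀ b c, ∀ t ∈ I, S c t ≠ 0 → deriv (fun s => S b s / S c s) t = 0) :
    ∃ (n : ℝ → ℝ) (v : ι → ℝ), ContDiffOn ℝ ∞ n I ∧ (∀ t ∈ I, 0 < n t) ∧
      ∀ t ∈ I, ∀ b, S b t = n t * v b := by
  have hd : ∀ b, ∀ t ∈ I, DifferentiableAt ℝ (S b) t := fun b t ht =>
    differentiableAt_of_smoothOn_real hI (hS b) ht
  have hW1 : ∀ b c, ∀ t ∈ I, S c t ≠ 0 → deriv (S b) t * S c t = S b t * deriv (S c) t := by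
    intro b c t ht hct
    have h1 := h b c t ht hct
    rw [deriv_fun_div (hd b t ht) (hd c t ht) hct, div_eq_zero_iff] at h1
    rcases h1 with h1 | h1
    · linarith
    · exact absurd h1 (pow_ne_zero 2 hct)
  -- The Wronskians vanish also at zeros of S_c: either S_b is nonzero there and the ratio is
  -- inverted, or both functions are zero.
  have hW : ∀ b c, ∀ t ∈ I, deriv (S b) t * S c t = S b t * deriv (S c) t := by
    intro b c t ht
    by_cases hct : S c t = 0
    · by_cases hbt : S b t = 0
      · simp [hct, hbt]
      · have := hW1 c b t ht hbt
        linarith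
    · exact hW1 b c t ht hct
  -- Division by the Euclidean norm is possible on all of `I`, whereas each single component may
  -- have zeros. The vanishing Wronskians make the normalised vector constant.
  let q : ℝ → ℝ := fun t => ∑ b, S b t ^ 2
  have hq : ∀ t ∈ I, 0 < q t := by
    intro t ht
    obtain ⟨b, hb⟩ := h0 t ht
    exact Finset.sum_pos' (fun _ _ => sq_nonneg _) ⟨b, Finset.mem_univ _, by positivity⟩
  have hqs : ContDiffOn ℝ ∞ q I := ContDiffOn.sum fun b _ => (hS b).pow 2
  have hn : ContDiffOn ℝ ∞ (fun t => √(q t)) I := hqs.sqrt fun t ht => (hq t ht).ne'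
  have hn0 : ∀ t ∈ I, 0 < √(q t) := fun t ht => Real.sqrt_pos.2 (hq t ht)
  have hus : ∀ b, ContDiffOn ℝ ∞ (fun t => S b t / √(q t)) I := fun b =>
    (hS b).div hn fun t ht => (hn0 t ht).ne'
  have hud : ∀ b, ∀ t ∈ I, deriv (fun t => S b t / √(q t)) t = 0 := by
    intro b t ht
    have hnd := differentiableAt_of_smoothOn_real hI hn ht
    have hqd := differentiableAt_of_smoothOn_real hI hqs ht
    have h1 : deriv (fun t => √(q t)) t = (∑ c, 2 * S c t * deriv (S c) t) / (2 * √(q t)) := by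
      rw [deriv_sqrt hqd (hq t ht).ne']
      congr 1
      rw [deriv_fun_sum fun c _ => ((hd c t ht).fun_pow 2)]
      refine Finset.sum_congr rfl fun c _ => ?_
      rw [deriv_fun_pow (hd c t ht)]
      simp
    rw [deriv_fun_div (hd b t ht) hnd (hn0 t ht).ne', div_eq_zero_iff]
    left
    rw [h1]
    have h2 : deriv (S b) t * q t = S b t * ∑ c, S c t * deriv (S c) t := by
      simp only [q, Finset.mul_sum]
      refine Finset.sum_congr rfl fun c _ => ?_
      linear_combination S c t * hW b c t ht
    have h3 : √(q t) * √(q t) = q t := Real.mul_self_sqrt (hq t ht).le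
    have h4 := (hn0 t ht).ne'
    have h5 : ∑ c, 2 * S c t * deriv (S c) t = 2 * ∑ c, S c t * deriv (S c) t := by
      rw [Finset.mul_sum]
      exact Finset.sum_congr rfl fun c _ => by ring
    rw [h5]
    field_simp
    rw [sq, h3]
    linarith
  rcases I.eq_empty_or_nonempty with rfl | ⟨t₀, ht₀⟩
  · exact ⟨fun _ => 1, 0, contDiffOn_const, by simp, by simp⟩
  refine ⟨fun t => √(q t), fun b => S b t₀ / √(q t₀), hn, hn0, fun t ht b => ?_⟩
  have h1 := hI.is_const_of_deriv_eq_zero hc.isPreconnected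
    (f := fun t => S b t / √(q t)) (fun t ht =>
      (differentiableAt_of_smoothOn_real hI (hus b) ht).differentiableWithinAt) (hud b) ht ht₀
  change S b t = √(q t) * (S b t₀ / √(q t₀))
  rw [← h1]
  have := (hn0 t ht).ne'
  field_simp

/-- A change of variable with prescribed positive derivative. -/
theorem exists_change_of_variable (hI : IsOpen I) (hc : Convex ℝ I) {h : ℝ → ℝ}
    (hh : ContDiffOn ℝ ∞ h I) (hpos : ∀ t ∈ I, 0 < h t) :
    ∃ p : OpenPartialHomeomorph ℝ ℝ, p.source = I ∧ ContDiffOn ℝ ∞ p I ∧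
      ContDiffOn ℝ ∞ p.symm p.target ∧ ∀ t ∈ I, HasDerivAt p (h t) t := by
  obtain ⟨ψ, hψ⟩ := hc.exists_forall_hasDerivWithinAt (hh.differentiableOn (by simp))
  have hψ : ∀ t ∈ I, HasDerivAt ψ (h t) t := fun t ht => (hψ t ht).hasDerivAt (hI.mem_nhds ht)
  have hsm : ContDiffOn ℝ ∞ ψ I := by
    rw [contDiffOn_infty_iff_deriv_of_isOpen hI]
    exact ⟨fun t ht => (hψ t ht).differentiableAt.differentiableWithinAt,
      hh.congr fun t ht => (hψ t ht).deriv⟩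
  have hinj : Set.InjOn ψ I := by
    refine (strictMonoOn_of_deriv_pos hc hsm.continuousOn fun t ht => ?_).injOn
    rw [hI.interior_eq] at ht
    rw [(hψ t ht).deriv]
    exact hpos t ht
  let P : PartialEquiv ℝ ℝ := hinj.bijOn_image.toPartialEquiv ψ I (ψ '' I)
  have hstrict : ∀ t ∈ I, HasStrictDerivAt ψ (h t) t := by
    intro t ht
    have := (hsm.contDiffAt (hI.mem_nhds ht)).hasStrictDerivAt (by simp)
    rwa [(hψ t ht).deriv] at this
  -- The map is open by the inverse function theorem, its derivative being nonzero.
  let p := OpenPartialHomeomorph.ofContinuousOpenRestrict P hsm.continuousOn (by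
    rw [isOpenMap_iff_nhds_le]
    rintro ⟨t, ht⟩
    have h1 := (hstrict t ht).map_nhds_eq (hpos t ht).ne'
    change 𝓝 (ψ t) ≤ Filter.map (ψ ∘ Subtype.val) (𝓝 (⟨t, ht⟩ : I))
    rw [← Filter.map_map, map_nhds_subtype_val, hI.nhdsWithin_eq ht, h1]) hI
  refine ⟨p, rfl, hsm, fun s hs => ?_, hψ⟩
  have ht : p.symm s ∈ I := p.map_target hs
  exact (p.contDiffAt_symm_deriv (hpos _ ht).ne' hs (hψ _ ht)
    (hsm.contDiffAt (hI.mem_nhds ht))).contDiffWithinAt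

end OneVariable

theorem IsRescaling.coord_mem {k r : ℕ} {Q : Type*} [TopologicalSpace Q]
    {e e' : OpenPartialHomeomorph Q (Coord k r)} {x : Q} {V : Set (Coord k r)} {a : Fin (k + 1)}
    {ψ : ℝ → ℝ} (hR : IsRescaling e e' V a ψ) (hx : x ∈ e'.source) : x ∈ e.source ∧ e x ∈ V := by
  rw [hR.source] at hx
  exact hx

/-! ### Rescaling one essential coordinate -/

section Rescaling

variable {k r m₀ : ℕ} {Q : Type*} [TopologicalSpace Q] [ChartedSpace (Coord k r) Q]
  {G : Tensor2 k r Q} {D : Submodule ℝ (VF k r Q)} {𝒦 : Submodule ℝ (Tensor2 k r Q)}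
  {ξ : Fin (k + 1) → OneForm k r Q} {e e' : OpenPartialHomeomorph Q (Coord k r)} {x : Q}
  {V : Set (Coord k r)} {a : Fin (k + 1)} {ψ : ℝ → ℝ}

theorem smooth_update (a : Fin (k + 1)) {f : ℝ → ℝ} {s : Set (Coord k r)}
    (hf : ContDiffOn ℝ ∞ (fun y : Coord k r => f (y (.inl a))) s) :
    ContDiffOn ℝ ∞ (fun y : Coord k r => Function.update y (.inl a) (f (y (.inl a)))) s := by
  rw [contDiffOn_pi]
  intro j
  by_cases hj : j = .inl a
  · subst hj
    simpa using hf
  · simp only [Function.update_of_ne hj]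
    exact (contDiff_apply ℝ ℝ j).contDiffOn

/-- Change of the coordinate `q^a` on `V`. -/
def rescaleCoord (p : OpenPartialHomeomorph ℝ ℝ) (a : Fin (k + 1)) (V : Set (Coord k r))
    (hV : IsOpen V) (hVp : ∀ y ∈ V, y (.inl a) ∈ p.source) (hp : ContDiffOn ℝ ∞ p p.source)
    (hp' : ContDiffOn ℝ ∞ p.symm p.target) :
    OpenPartialHomeomorph (Coord k r) (Coord k r) where
  toFun y := Function.update y (.inl a) (p (y (.inl a)))
  invFun y := Function.update y (.inl a) (p.symm (y (.inl a)))
  source := V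
  target := {y | y (.inl a) ∈ p.target} ∩
    (fun y : Coord k r => Function.update y (.inl a) (p.symm (y (.inl a)))) ⁻¹' V
  map_source' y hy := by
    simp [p.left_inv (hVp y hy), p.map_source (hVp y hy), hy]
  map_target' y hy := hy.2
  left_inv' y hy := by simp [p.left_inv (hVp y hy)]
  right_inv' y hy := by
    have h1 : y (.inl a) ∈ p.target := hy.1
    simp [p.right_inv h1]
  open_source := hV
  open_target := by
    refine ContinuousOn.isOpen_inter_preimage ?_
      (p.open_target.preimage (continuous_apply (Sum.inl a))) hV
    exact (smooth_update a (hp'.comp (contDiff_apply ℝ ℝ (Sum.inl a)).contDiffOn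
      fun y hy => hy)).continuousOn
  continuousOn_toFun := (smooth_update a (hp.comp (contDiff_apply ℝ ℝ (Sum.inl a)).contDiffOn
      fun y hy => hVp y hy)).continuousOn
  continuousOn_invFun := (smooth_update a (hp'.comp (contDiff_apply ℝ ℝ (Sum.inl a)).contDiffOn
      fun y hy => hy.1)).continuousOn

theorem rescaleCoord_mem_groupoid (p : OpenPartialHomeomorph ℝ ℝ) (a : Fin (k + 1))
    (V : Set (Coord k r)) (hV : IsOpen V) (hVp : ∀ y ∈ V, y (.inl a) ∈ p.source)
    (hp : ContDiffOn ℝ ∞ p p.source) (hp' : ContDiffOn ℝ ∞ p.symm p.target) :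
    rescaleCoord p a V hV hVp hp hp' ∈ contDiffGroupoid ∞ (Mdl k r) := by
  rw [contDiffGroupoid, mem_groupoid_of_pregroupoid]
  have h1 : ContDiffOn ℝ ∞ (rescaleCoord p a V hV hVp hp hp')
      (rescaleCoord p a V hV hVp hp hp').source :=
    smooth_update a (hp.comp (contDiff_apply ℝ ℝ (Sum.inl a)).contDiffOn fun y hy => hVp y hy)
  have h2 : ContDiffOn ℝ ∞ (rescaleCoord p a V hV hVp hp hp').symm
      (rescaleCoord p a V hV hVp hp hp').target :=
    smooth_update a (hp'.comp (contDiff_apply ℝ ℝ (Sum.inl a)).contDiffOn fun y hy => hy.1)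
  constructor
  · simpa [contDiffPregroupoid] using h1
  · simpa [contDiffPregroupoid] using h2

theorem trans_mem_maximalAtlas (he : e ∈ IsManifold.maximalAtlas (Mdl k r) ∞ Q)
    {Φ : OpenPartialHomeomorph (Coord k r) (Coord k r)}
    (hΦ : Φ ∈ contDiffGroupoid ∞ (Mdl k r)) :
    e ≫ₕ Φ ∈ IsManifold.maximalAtlas (Mdl k r) ∞ Q := by
  intro f hf
  obtain ⟨h1, h2⟩ := he f hf
  constructor
  · rw [OpenPartialHomeomorph.trans_symm_eq_symm_trans_symm, OpenPartialHomeomorph.trans_assoc]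
    exact StructureGroupoid.trans _ (StructureGroupoid.symm _ hΦ) h1
  · rw [← OpenPartialHomeomorph.trans_assoc]
    exact StructureGroupoid.trans _ h2 hΦ

theorem isOpen_image_eval (hV : IsOpen V) (i : Fin (k + 1) ⊕ Fin r) :
    IsOpen ((fun y : Coord k r => y i) '' V) :=
  isOpenMap_eval i V hV

theorem convex_image_eval (hV : Convex ℝ V) (i : Fin (k + 1) ⊕ Fin r) :
    Convex ℝ ((fun y : Coord k r => y i) '' V) :=
  hV.linear_image (LinearMap.proj (R := ℝ) (φ := fun _ : Fin (k + 1) ⊕ Fin r => ℝ) i)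

/-- The factor by which the differential of the `i`-th coordinate is multiplied. -/
def rescaleFactor (ψ : ℝ → ℝ) (a : Fin (k + 1)) (i : Fin (k + 1) ⊕ Fin r) (t : ℝ) : ℝ :=
  if i = .inl a then deriv ψ t else 1

theorem exists_rescaling (he : e ∈ IsManifold.maximalAtlas (Mdl k r) ∞ Q)
    (hV : IsOpen V) (p : OpenPartialHomeomorph ℝ ℝ)
    (hpV : p.source = (fun y : Coord k r => y (.inl a)) '' V) (hp : ContDiffOn ℝ ∞ p p.source)
    (hp' : ContDiffOn ℝ ∞ p.symm p.target) (hd : ∀ t ∈ p.source, deriv p t ≠ 0) :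
    ∃ e' ∈ IsManifold.maximalAtlas (Mdl k r) ∞ Q, IsRescaling e e' V a p := by
  have hVp : ∀ y ∈ V, y (.inl a) ∈ p.source := fun y hy => hpV ▸ ⟨y, hy, rfl⟩
  refine ⟨_, trans_mem_maximalAtlas he (rescaleCoord_mem_groupoid p a V hV hVp hp hp'), ?_⟩
  exact ⟨hpV ▸ hp, fun y hy => hd _ (hVp y hy), rfl, fun x _ => rfl⟩

theorem comp_apply (T : Tensor2 k r Q) (hx : x ∈ e.source) (i j : Fin (k + 1) ⊕ Fin r) :
    comp T e i j (e x) = T x (dq e i x) (dq e j x) := by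
  rw [comp, e.left_inv hx]

variable [IsManifold (Mdl k r) ∞ Q]

theorem hasMFDerivAt_comp_coord (he : e ∈ IsManifold.maximalAtlas (Mdl k r) ∞ Q)
    (hx : x ∈ e.source) {i : Fin (k + 1) ⊕ Fin r} {f : ℝ → ℝ}
    (hf : DifferentiableAt ℝ f (e x i)) :
    (mfderiv (Mdl k r) 𝓘(ℝ, ℝ) (fun y => f (e y i)) x : Cot k r Q x)
      = deriv f (e x i) • dq e i x := by
  have h1 : HasMFDerivAt 𝓘(ℝ, ℝ) 𝓘(ℝ, ℝ) f (e x i) _ := hf.hasDerivAt.hasFDerivAt.hasMFDerivAt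
  have h2 := (mdifferentiableAt_coord he hx i).hasMFDerivAt
  have h3 := (HasMFDerivAt.comp x h1 h2).mfderiv
  refine h3.trans ?_
  ext v
  change dq e i x v • deriv f (e x i) = deriv f (e x i) • dq e i x v
  simp [mul_comm]

namespace IsRescaling

theorem dq_eq (hR : IsRescaling e e' V a ψ) (he : e ∈ IsManifold.maximalAtlas (Mdl k r) ∞ Q)
    (hV : IsOpen V) (hx : x ∈ e'.source) (i : Fin (k + 1) ⊕ Fin r) :
    dq e' i x = rescaleFactor ψ a i (e x (.inl a)) • dq e i x := by
  obtain ⟨hxe, hxV⟩ := hR.coord_mem hx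
  by_cases hi : i = .inl a
  · subst hi
    have hψ : DifferentiableAt ℝ ψ (e x (.inl a)) :=
      differentiableAt_of_smoothOn_real (isOpen_image_eval hV _) hR.smooth ⟨_, hxV, rfl⟩
    have h1 : (fun y => e' y (.inl a)) =ᶠ[𝓝 x] fun y => ψ (e y (.inl a)) := by
      filter_upwards [e'.open_source.mem_nhds hx] with y hy
      rw [hR.coord y hy]
      simp
    rw [dq, h1.mfderiv_eq]
    rw [rescaleFactor, if_pos rfl]
    exact hasMFDerivAt_comp_coord he hxe hψ
  · have h1 : (fun y => e' y i) =ᶠ[𝓝 x] fun y => e y i := by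
      filter_upwards [e'.open_source.mem_nhds hx] with y hy
      rw [hR.coord y hy]
      simp [hi]
    rw [dq, h1.mfderiv_eq]
    rw [rescaleFactor, if_neg hi]
    exact (one_smul ℝ (dq e i x)).symm

theorem isCompatibleChart (hR : IsRescaling e e' V a ψ) (hP : IsCompatibleChart D ξ e)
    (hV : IsOpen V) (he' : e' ∈ IsManifold.maximalAtlas (Mdl k r) ∞ Q) :
    IsCompatibleChart D ξ e' where
  mem_atlas := he'
  essential c x hx := by
    obtain ⟨t, ht⟩ := hP.essential c x (hR.coord_mem hx).1
    rw [hR.dq_eq hP.mem_atlas hV hx, ht, smul_smul]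
    exact ⟨_, rfl⟩
  ignorable := by
    obtain ⟨X, hX⟩ := hP.ignorable
    refine ⟨X, fun α x hx i => ?_⟩
    rw [hR.dq_eq hP.mem_atlas hV hx]
    change rescaleFactor ψ a i (e x (.inl a)) * dq e i x ((X α : VF k r Q) x) = _
    rw [hX α x (hR.coord_mem hx).1]
    by_cases hi : i = .inr α
    · simp [hi, rescaleFactor]
    · simp [hi]

theorem comp_eq (hR : IsRescaling e e' V a ψ) (he : e ∈ IsManifold.maximalAtlas (Mdl k r) ∞ Q)
    (hV : IsOpen V) (T : Tensor2 k r Q) (hx : x ∈ e'.source) (i j : Fin (k + 1) ⊕ Fin r) :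
    comp T e' i j (e' x) = rescaleFactor ψ a i (e x (.inl a)) *
      rescaleFactor ψ a j (e x (.inl a)) * comp T e i j (e x) := by
  rw [comp_apply T hx, comp_apply T (hR.coord_mem hx).1, hR.dq_eq he hV hx, hR.dq_eq he hV hx]
  simp only [map_smul, LinearMap.smul_apply, smul_eq_mul]
  ring

end IsRescaling

end Rescaling

/-! ### Stäckel matrices under rescaling, and the fundamental functions -/

section RescaledStackel

variable {k r : ℕ}

/-- From S = diag(d) S' follows S'⁻¹ = S⁻¹ diag(d): dividing a row multiplies the corresponding
column of the inverse. -/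
theorem phi_row_rescaling {S S' : Fin (k + 1) → Fin (k + 1) → ℝ → ℝ} {y z : Coord k r}
    {d : Fin (k + 1) → ℝ} (hS : (stackelMatrix S z).det ≠ 0)
    (h : ∀ c b, S c b (z (.inl c)) = d c * S' c b (y (.inl c))) :
    (stackelMatrix S' y).det ≠ 0 ∧ ∀ b c, phi S' b c y = phi S b c z * d c := by
  have h1 : stackelMatrix S z = Matrix.diagonal d * stackelMatrix S' y := by
    ext c b
    rw [Matrix.diagonal_mul]
    exact h c b
  have h2 : stackelMatrix S' y * ((stackelMatrix S z)⁻¹ * Matrix.diagonal d) = 1 := by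
    have h3 : stackelMatrix S z * (stackelMatrix S z)⁻¹ = 1 := Matrix.mul_nonsing_inv _ hS.isUnit
    rw [h1, mul_assoc] at h3
    have h4 := mul_eq_one_comm.1 h3
    rw [← h1] at h4
    rw [← mul_assoc]
    exact h4
  refine ⟨fun h0 => ?_, fun b c => ?_⟩
  · rw [h1, Matrix.det_mul, h0, mul_zero] at hS
    exact hS rfl
  · rw [phi, Matrix.inv_eq_right_inv h2, Matrix.mul_diagonal]
    rfl

theorem isStackelSymmetry_of_const {Q : Type*} [TopologicalSpace Q]
    {S : Fin (k + 1) → Fin (k + 1) → ℝ → ℝ} {e : OpenPartialHomeomorph Q (Coord k r)}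
    {a : Fin (k + 1)} {v : Fin (k + 1) → ℝ} (hS : ∀ b t, S a b t = v b) :
    IsStackelSymmetry S e a := by
  intro y _ b
  set F : Coord k r → ℝ := fun z => Real.log (phi S (Fin.last k) b z) with hF
  have hconst : ∀ t : ℝ, F (y + t • Pi.single (.inl a) 1) = F y := by
    intro t
    have : stackelMatrix S (y + t • Pi.single (.inl a) 1) = stackelMatrix S y := by
      ext c d
      by_cases hc : c = a
      · subst hc
        simp [stackelMatrix, hS]
      · simp [stackelMatrix, hc]
    simp only [hF, phi, this]
  -- Differentiability of F is not among the hypotheses; without it `fderiv` is 0 by convention.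
  by_cases hd : DifferentiableAt ℝ F y
  · have h1 := hd.lineDeriv_eq_fderiv (v := (Pi.single (.inl a) 1 : Coord k r))
    rw [pd, ← h1, lineDeriv]
    simp [hconst]
  · rw [pd, fderiv_zero_of_not_differentiableAt hd]
    rfl

/-- The factor det Λ · φ^a_{(m)} is common to all minors with the a-th column removed, so it cancels
in the quotient. -/
theorem fund_eq_div {Q : Type*} {S : Fin (k + 1) → Fin (k + 1) → ℝ → ℝ} {x : Q}
    {M : Q → Matrix (Fin (k + 1)) (Fin (k + 1)) ℝ} {y : Coord k r}
    (hreg : (stackelMatrix S y).det ≠ 0) (hne : ∀ a, phi S (Fin.last k) a y ≠ 0)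
    (h : ∀ b a, phi S b a y = M x b a * phi S (Fin.last k) a y) (a b c : Fin (k + 1)) :
    (minor (M x) c a ≠ 0 ↔ S a c (y (.inl a)) ≠ 0) ∧
      fund M a b c x = (-1) ^ (b + c : ℕ) * (S a b (y (.inl a)) / S a c (y (.inl a))) := by
  have hmin : ∀ b, minor (M x) b a = (-1) ^ (b + a : ℕ) *
      ((M x).det * phi S (Fin.last k) a y * S a b (y (.inl a))) :=
    fun b => (minor_eq_of_inv hreg h b a).2
  have hdet := (minor_eq_of_inv hreg h b a).1
  have hs : ∀ m : ℕ, (-1 : ℝ) ^ m ≠ 0 := fun m => pow_ne_zero _ (by norm_num)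
  have hu : (M x).det * phi S (Fin.last k) a y ≠ 0 := mul_ne_zero hdet (hne a)
  constructor
  · rw [hmin]
    simp [hs, hdet, hne a]
  · rw [fund, hmin, hmin]
    have h1 : (-1 : ℝ) ^ (b + a : ℕ) / (-1) ^ (c + a : ℕ) = (-1) ^ (b + c : ℕ) := by
      rw [div_eq_iff (hs _), ← pow_add]
      have : (b + c + (c + a) : ℕ) = (b + a) + 2 * c := by ring
      rw [this, pow_add _ (b + a : ℕ), pow_mul]
      simp
    rw [mul_div_mul_comm, h1, mul_div_mul_left _ _ hu]

theorem StackelForm.fund_eq {Q : Type*} [TopologicalSpace Q] [ChartedSpace (Coord k r) Q]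
    {G : Tensor2 k r Q} {𝒦 : Submodule ℝ (Tensor2 k r Q)}
    {K : Module.Basis (Fin (k + 1)) ℝ 𝒦} {Λ : Q → Matrix (Fin (k + 1)) (Fin (k + 1)) ℝ}
    {e : OpenPartialHomeomorph Q (Coord k r)} {x : Q} {V : Set (Coord k r)}
    {N : Set (Fin (k + 1))} {S : Fin (k + 1) → Fin (k + 1) → ℝ → ℝ}
    {θ : Fin (k + 1) → Fin r → ℝ → ℝ} {η : Fin (k + 1) → Fin r → Fin r → ℝ → ℝ}
    (hS : StackelForm V (comp G e)
      (fun b => comp (K b : Tensor2 k r Q) e) (fun y => Λ (e.symm y)) N S θ η)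
    (hx : x ∈ e.source) (hxV : e x ∈ V) (a b c : Fin (k + 1)) :
    (minor (Λ x) c a ≠ 0 ↔ S a c (e x (.inl a)) ≠ 0) ∧
      fund Λ a b c x = (-1) ^ (b + c : ℕ) * (S a b (e x (.inl a)) / S a c (e x (.inl a))) := by
  have h := hS.eigen _ hxV
  simp only [e.left_inv hx] at h
  exact fund_eq_div (hS.regular _ hxV) (hS.phi_ne_zero _ hxV) h a b c

end RescaledStackel

/-! ### The two alternatives -/

section Main

variable {k r m₀ : ℕ} {Q : Type*} [TopologicalSpace Q] [ChartedSpace (Coord k r) Q]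
  [IsManifold (Mdl k r) ∞ Q]
  {G : Tensor2 k r Q} {D : Submodule ℝ (VF k r Q)} {𝒦 : Submodule ℝ (Tensor2 k r Q)}
  {ξ : Fin (k + 1) → OneForm k r Q} {e e' : OpenPartialHomeomorph Q (Coord k r)} {x : Q}
  {V : Set (Coord k r)} {a : Fin (k + 1)} {ψ : ℝ → ℝ}
  {K : Module.Basis (Fin (k + 1)) ℝ 𝒦} {Λ : Q → Matrix (Fin (k + 1)) (Fin (k + 1)) ℝ}
  {N : Set (Fin (k + 1))} {S : Fin (k + 1) → Fin (k + 1) → ℝ → ℝ}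
  {θ : Fin (k + 1) → Fin r → ℝ → ℝ} {η : Fin (k + 1) → Fin r → Fin r → ℝ → ℝ}

/-- Replacing the row n v by v multiplies φ^a_{(b)} by n, while the rescaling multiplies K_b^{aa} by
ψ'² and K_b^{aβ} by ψ'. The choice ψ' = √n matches the diagonal terms. -/
theorem exists_standard_of_row_eq (hP : IsCompatibleChart D ξ e)
    (hA : IsSeparableKillingAlgebra G D 𝒦 ξ m₀)
    (H : CoordAlgebra V (comp G e) (fun b => comp (K b : Tensor2 k r Q) e)
      (fun y => Λ (e.symm y)) N)
    (hS : StackelForm V (comp G e) (fun b => comp (K b : Tensor2 k r Q) e)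
      (fun y => Λ (e.symm y)) N S θ η)
    {n : ℝ → ℝ} {v : Fin (k + 1) → ℝ}
    (hn : ContDiffOn ℝ ∞ n ((fun y : Coord k r => y (.inl a)) '' V))
    (hn0 : ∀ t ∈ (fun y : Coord k r => y (.inl a)) '' V, 0 < n t)
    (hrow : ∀ t ∈ (fun y : Coord k r => y (.inl a)) '' V, ∀ b, S a b t = n t * v b) :
    ∃ e' ∈ IsManifold.maximalAtlas (Mdl k r) ∞ Q, ∃ ψ : ℝ → ℝ, IsRescaling e e' V a ψ ∧
      ∃ null S θ η, IsStandard G (fun i => (K i : Tensor2 k r Q)) e' null S θ η ∧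
        IsStackelSymmetry S e' a ∧ IndependentOf S e' a := by
  have hIo := isOpen_image_eval H.isOpen (.inl a)
  obtain ⟨p, hps, hp, hp', hpd⟩ := exists_change_of_variable hIo
    (convex_image_eval H.convex (.inl a)) (hn.sqrt fun t ht => (hn0 t ht).ne')
    (fun t ht => Real.sqrt_pos.2 (hn0 t ht))
  have hder : ∀ t ∈ p.source, deriv p t = √(n t) := fun t ht => (hpd t (hps ▸ ht)).deriv
  obtain ⟨e', he', hR⟩ := exists_rescaling (a := a) hP.mem_atlas H.isOpen p hps (hps ▸ hp) hp'
    (fun t ht => by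
      rw [hder t ht]
      exact (Real.sqrt_pos.2 (hn0 t (hps ▸ ht))).ne')
  have hP' := hR.isCompatibleChart hP H.isOpen he'
  -- For isotropic q^a the factors √n of K_b^{aβ} and n of φ^a_{(b)} leave θ / √n; the unchanged
  -- g^{αβ} requires η / n.
  let S' : Fin (k + 1) → Fin (k + 1) → ℝ → ℝ := fun c b t => if c = a then v b else S c b t
  let θ' : Fin (k + 1) → Fin r → ℝ → ℝ := fun c β t =>
    if c = a then θ c β (p.symm t) / √(n (p.symm t)) else θ c β t
  let η' : Fin (k + 1) → Fin r → Fin r → ℝ → ℝ := fun c α β t =>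
    if c = a then η c α β (p.symm t) / n (p.symm t) else η c α β t
  have himg : ∀ y ∈ e'.target, ∃ z ∈ V, e (e'.symm y) = z ∧ p (z (.inl a)) = y (.inl a) ∧
      ∀ i, i ≠ .inl a → z i = y i := by
    intro y hy
    have hx := e'.map_target hy
    refine ⟨_, (hR.coord_mem hx).2, rfl, ?_, fun i hi => ?_⟩
    · conv_rhs => rw [← e'.right_inv hy, hR.coord _ hx]
      simp
    · conv_rhs => rw [← e'.right_inv hy, hR.coord _ hx]
      simp [hi]
  have hcomp : ∀ (T : Tensor2 k r Q), ∀ y ∈ e'.target, ∀ i j, comp T e' i j y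
      = rescaleFactor p a i (e (e'.symm y) (.inl a)) *
        rescaleFactor p a j (e (e'.symm y) (.inl a)) * comp T e i j (e (e'.symm y)) := by
    intro T y hy i j
    have := hR.comp_eq hP.mem_atlas H.isOpen T (e'.map_target hy) i j
    rwa [e'.right_inv hy] at this
  have hfac : ∀ (z : Coord k r), z ∈ V → rescaleFactor (r := r) p a (.inl a) (z (.inl a))
      = √(n (z (.inl a))) := fun z hz => by
    rw [rescaleFactor, if_pos rfl, hder _ (hps ▸ ⟨z, hz, rfl⟩)]
  have hfac' : ∀ (i : Fin (k + 1) ⊕ Fin r) (t : ℝ), i ≠ .inl a → rescaleFactor p a i t = 1 :=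
      fun i t hi => by
    rw [rescaleFactor, if_neg hi]
  have hsub : ∀ c, c ≠ a → (fun y : Coord k r => y (.inl c)) '' e'.target
      ⊆ (fun y : Coord k r => y (.inl c)) '' V := by
    rintro c hc _ ⟨y, hy, rfl⟩
    obtain ⟨z, hz, -, -, hz'⟩ := himg y hy
    exact ⟨z, hz, hz' _ (by simpa using hc)⟩
  have hsub' : (fun y : Coord k r => y (.inl a)) '' e'.target ⊆ p.target := by
    rintro _ ⟨y, hy, rfl⟩
    obtain ⟨z, hz, -, hz', -⟩ := himg y hy
    change y (.inl a) ∈ p.target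
    rw [← hz']
    exact p.map_source (hps ▸ ⟨z, hz, rfl⟩)
  have hpsymm : ∀ y ∈ e'.target, p.symm (y (.inl a)) = e (e'.symm y) (.inl a) := by
    intro y hy
    obtain ⟨z, hz, hze, hz', -⟩ := himg y hy
    rw [← hz', hze]
    exact p.left_inv (hps ▸ ⟨z, hz, rfl⟩)
  have hpm : ∀ {f : ℝ → ℝ}, ContDiffOn ℝ ∞ f ((fun y : Coord k r => y (.inl a)) '' V) →
      ContDiffOn ℝ ∞ (fun t => f (p.symm t)) ((fun y : Coord k r => y (.inl a)) '' e'.target) := by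
    intro f hf
    refine hf.comp (hp'.mono hsub') fun t ht => ?_
    exact hps ▸ p.map_target (hsub' ht)
  have hnz : ∀ t ∈ (fun y : Coord k r => y (.inl a)) '' e'.target, 0 < n (p.symm t) :=
    fun t ht => hn0 _ (hps ▸ p.map_target (hsub' ht))
  have hphi : ∀ y ∈ e'.target, (stackelMatrix S' y).det ≠ 0 ∧ ∀ b c,
      phi S' b c y = phi S b c (e (e'.symm y)) *
        if c = a then n (e (e'.symm y) (.inl a)) else 1 := by
    intro y hy
    obtain ⟨z, hz, hze, hz', hz''⟩ := himg y hy
    rw [hze]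
    refine phi_row_rescaling (hS.regular z hz) fun c b => ?_
    by_cases hc : c = a
    · subst hc
      simpa [S'] using hrow _ ⟨z, hz, rfl⟩ b
    · simp [S', hc, hz'' (.inl c) (by simpa using hc)]
  refine ⟨e', he', p, hR, N, S', θ', η', ⟨?_, ?_, ?_, fun y hy => (hphi y hy).1, ?_, ?_, ?_, ?_, ?_⟩,
    isStackelSymmetry_of_const (v := v) fun b t => by simp [S'], ?_⟩
  · intro c b
    by_cases hc : c = a
    · simpa [S', hc] using contDiffOn_const
    · simpa [S', hc] using (hS.smooth_S c b).mono (hsub c hc)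
  · intro c β
    by_cases hc : c = a
    · subst hc
      simp only [θ', if_true]
      exact (hpm (hS.smooth_θ c β)).div ((hpm hn).sqrt fun t ht => (hnz t ht).ne')
        fun t ht => (Real.sqrt_pos.2 (hnz t ht)).ne'
    · simpa [θ', hc] using (hS.smooth_θ c β).mono (hsub c hc)
  · intro c α β
    by_cases hc : c = a
    · subst hc
      simp only [η', if_true]
      exact (hpm (hS.smooth_η c α β)).div (hpm hn) fun t ht => (hnz t ht).ne'
    · simpa [η', hc] using (hS.smooth_η c α β).mono (hsub c hc)
  · exact fun y hy α i j => hP'.pd_comp (fun X hX => hA.killing_D X hX) hy α i j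
  · intro y hy b c d hcd
    obtain ⟨z, hz, hze, -, -⟩ := himg y hy
    rw [hcomp _ y hy, hze, H.eigen z hz b c, H.orth z hz c d hcd]
    simp
  · intro y hy b c hc
    obtain ⟨z, hz, hze, -, -⟩ := himg y hy
    constructor
    · rw [hcomp _ y hy, hze, hS.diag z hz b c hc, (hphi y hy).2, hze]
      by_cases hca : c = a
      · subst hca
        rw [hfac z hz, if_pos rfl, Real.mul_self_sqrt (hn0 _ ⟨z, hz, rfl⟩).le, mul_comm]
      · rw [hfac' _ _ (by simpa using hca), if_neg hca]
        ring
    · intro β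
      rw [hcomp _ y hy, hze, H.eigen z hz b c, H.origin z hz c hc]
      simp
  · intro y hy b c hc
    obtain ⟨z, hz, hze, hz', hz''⟩ := himg y hy
    constructor
    · rw [hcomp _ y hy, hze, H.eigen z hz b c, H.null z hz c hc]
      simp
    · intro β
      rw [hcomp _ y hy, hze, hS.isotropic z hz b c hc, (hphi y hy).2, hze, hfac' (.inr β) _ (by simp)]
      by_cases hca : c = a
      · subst hca
        have h1 := hn0 _ ⟨z, hz, rfl⟩
        have h2 := (Real.sqrt_pos.2 h1).ne'
        have h3 := Real.mul_self_sqrt h1.le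
        simp only [θ', if_true, hpsymm y hy, hze]
        rw [hfac z hz]
        field_simp
        linear_combination θ c β (z (.inl c)) * phi S b c z * h3
      · rw [hfac' _ _ (by simpa using hca), if_neg hca]
        simp [θ', hca, hz'' (.inl c) (by simpa using hca)]
  · intro y hy α β
    obtain ⟨z, hz, hze, hz', hz''⟩ := himg y hy
    rw [hcomp _ y hy, hze, hS.block z hz, hfac' (.inr α) _ (by simp), hfac' (.inr β) _ (by simp),
      one_mul, one_mul]
    refine Finset.sum_congr rfl fun c _ => ?_
    rw [(hphi y hy).2, hze]
    by_cases hca : c = a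
    · subst hca
      have h1 := (hn0 _ ⟨z, hz, rfl⟩).ne'
      simp only [η', if_true, hpsymm y hy, hze]
      field_simp
    · simp [η', hca, hz'' (.inl c) (by simpa using hca)]
  · intro y _ z _ hyz
    ext c b
    by_cases hca : c = a
    · simp [stackelMatrix, S', hca]
    · simp [stackelMatrix, S', hca, hyz (.inl c) (by simpa using hca)]

/-- Row a of the metric has a nonzero entry, and in standard form it is φ^a_{(m)} or θ φ^a_{(m)}.
Comparison with the same entry of K_b = λ_b^a G yields the eigenvalue. Nothing about the set `N` is
needed beyond the standard form. -/
theorem IsStandard.eigenvalue (hst : IsStandard G (fun i => (K i : Tensor2 k r Q)) e N S θ η)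
    (hP : IsCompatibleChart D ξ e) (hG : IsMetric G)
    (hK : (K (Fin.last k) : Tensor2 k r Q) = G)
    (hΛ : IsEigenvalueMatrix G (fun i => (K i : Tensor2 k r Q)) ξ Λ) {y : Coord k r}
    (hy : y ∈ e.target) (a : Fin (k + 1)) : phi S (Fin.last k) a y ≠ 0 ∧
      ∀ b, phi S b a y = Λ (e.symm y) b a * phi S (Fin.last k) a y := by
  have hrow : ∃ j, comp G e (.inl a) j y ≠ 0 := by
    by_contra! h
    exact (linearIndependent_gram hP.mem_atlas (e.map_target hy) hG).ne_zero (Sum.inl a)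
      (funext fun j => h j)
  have hoff : ∀ c, a ≠ c → comp G e (.inl a) (.inl c) y = 0 := fun c hac => by
    have := hst.offdiag y hy (Fin.last k) a c hac
    rwa [hK] at this
  have heig := fun b j => comp_eigen hP hΛ hy b a j
  by_cases ha : a ∈ N
  · have hiso := hst.isotropic y hy
    have hG' := hiso (Fin.last k) a ha
    rw [hK] at hG'
    obtain ⟨β, hβ⟩ : ∃ β, comp G e (.inl a) (.inr β) y ≠ 0 := by
      obtain ⟨j, hj⟩ := hrow
      rcases j with c | β
      · by_cases hac : a = c
        · subst hac
          exact absurd hG'.1 hj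
        · exact absurd (hoff c hac) hj
      · exact ⟨β, hj⟩
    rw [hG'.2 β] at hβ
    refine ⟨right_ne_zero_of_mul hβ, fun b => ?_⟩
    have h1 := heig b (.inr β)
    rw [hG'.2 β, (hiso b a ha).2 β] at h1
    refine mul_left_cancel₀ (left_ne_zero_of_mul hβ) ?_
    rw [h1]
    ring
  · have hdiag := hst.diag y hy
    have hG' := hdiag (Fin.last k) a ha
    rw [hK] at hG'
    have h0 : comp G e (.inl a) (.inl a) y ≠ 0 := by
      obtain ⟨j, hj⟩ := hrow
      rcases j with c | β
      · by_cases hac : a = c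
        · subst hac
          exact hj
        · exact absurd (hoff c hac) hj
      · exact absurd (hG'.2 β) hj
    refine ⟨hG'.1 ▸ h0, fun b => ?_⟩
    rw [← (hdiag b a ha).1, ← hG'.1]
    exact heig b (.inl a)

/-- A Stäckel matrix independent of `q^a` forces the functions `f_a^{bc}` to be locally
constant. -/
theorem not_isRegularPoint_of_symmetry (hP : IsCompatibleChart D ξ e) (hG : IsMetric G)
    (hK : (K (Fin.last k) : Tensor2 k r Q) = G)
    (hΛ : IsEigenvalueMatrix G (fun i => (K i : Tensor2 k r Q)) ξ Λ)
    (hsym : SymmetryAfterRescaling G (fun i => (K i : Tensor2 k r Q)) e a) (hx : x ∈ e.source)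
    (b c : Fin (k + 1)) : ¬ IsRegularPoint (r := r) Λ a b c x := by
  obtain ⟨ε, hε, hball⟩ := Metric.isOpen_iff.1 e.open_target (e x) (e.map_source hx)
  obtain ⟨e', he', ψ, hR, N, S, θ, η, hst, -, hind⟩ :=
    hsym (Metric.ball (e x) ε) hball Metric.isOpen_ball (convex_ball _ _)
  have hP' := hR.isCompatibleChart hP Metric.isOpen_ball he'
  have hx' : x ∈ e'.source := by
    rw [hR.source]
    exact ⟨hx, Metric.mem_ball_self hε⟩
  have hconst : ∀ z ∈ e'.source, ∀ d, S a d (e' z (.inl a)) = S a d (e' x (.inl a)) := by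
    intro z hz d
    obtain ⟨-, hzV⟩ := hR.coord_mem hz
    -- This point has the a-th coordinate of `z` and the others of `x`. It stays in the ball because
    -- balls of the sup norm are products of intervals.
    set w : Coord k r := Function.update (e x) (.inl a) (e z (.inl a)) with hw
    have hwV : w ∈ Metric.ball (e x) ε := by
      rw [Metric.mem_ball, dist_pi_lt_iff hε] at hzV ⊢
      intro j
      by_cases hj : j = .inl a
      · subst hj
        simpa [hw] using hzV (.inl a)
      · simp [hw, hj, hε]
    have hxw : e.symm w ∈ e'.source := by
      rw [hR.source]
      refine ⟨e.map_target (hball hwV), ?_⟩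
      rw [Set.mem_preimage, e.right_inv (hball hwV)]
      exact hwV
    have he'w := hR.coord _ hxw
    rw [e.right_inv (hball hwV)] at he'w
    have h1 : e' (e.symm w) (.inl a) = e' z (.inl a) := by
      rw [he'w, hR.coord z hz]
      simp [hw]
    have h2 := hind _ (e'.map_source hxw) _ (e'.map_source hx') fun i hi => by
      rw [he'w, hR.coord x hx']
      simp [hi, hw]
    have h3 := congrFun (congrFun h2 a) d
    simp only [stackelMatrix, Matrix.of_apply] at h3
    rw [← h1, h3]
  have hfund : ∀ z ∈ e'.source, fund Λ a b c z
      = (-1) ^ (b + c : ℕ) * (S a b (e' x (.inl a)) / S a c (e' x (.inl a))) := by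
    intro z hz
    have hy := e'.map_source hz
    have hev := fun d => hst.eigenvalue hP' hG hK hΛ hy d
    simp only [e'.left_inv hz] at hev
    rw [(fund_eq_div (hst.regular _ hy) (fun d => (hev d).1) (fun b d => (hev d).2 b) a b c).2,
      hconst z hz b, hconst z hz c]
  rintro ⟨-, h⟩
  apply h
  have : fund Λ a b c =ᶠ[𝓝 x] fun _ =>
      (-1) ^ (b + c : ℕ) * (S a b (e' x (.inl a)) / S a c (e' x (.inl a))) := by
    filter_upwards [e'.open_source.mem_nhds hx'] with z hz using hfund z hz
  rw [this.mfderiv_eq]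
  exact mfderiv_const

/-- Near `x`, f_a^{bc} is ± (S_ab / S_ac)(q^a), and dq^a ≠ 0. -/
theorem StackelForm.isRegularPoint_iff (hS : StackelForm V (comp G e)
      (fun b => comp (K b : Tensor2 k r Q) e) (fun y => Λ (e.symm y)) N S θ η)
    (he : e ∈ IsManifold.maximalAtlas (Mdl k r) ∞ Q) (hV : IsOpen V)
    (hx : x ∈ e.source) (hxV : e x ∈ V) (a b c : Fin (k + 1)) :
    IsRegularPoint (r := r) Λ a b c x ↔ S a c (e x (.inl a)) ≠ 0 ∧
      deriv (fun t => S a b t / S a c t) (e x (.inl a)) ≠ 0 := by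
  rw [IsRegularPoint, (hS.fund_eq hx hxV a b c).1]
  refine and_congr_right fun hc => not_congr ?_
  have hI := isOpen_image_eval hV (.inl a)
  have hmem : e x (.inl a) ∈ (fun y : Coord k r => y (.inl a)) '' V := ⟨_, hxV, rfl⟩
  have hd : DifferentiableAt ℝ (fun t => S a b t / S a c t) (e x (.inl a)) :=
    (differentiableAt_of_smoothOn_real hI (hS.smooth_S a b) hmem).fun_div
      (differentiableAt_of_smoothOn_real hI (hS.smooth_S a c) hmem) hc
  have heq : fund Λ a b c =ᶠ[𝓝 x] fun z =>
      (fun t => (-1 : ℝ) ^ (b + c : ℕ) * (S a b t / S a c t)) (e z (.inl a)) := by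
    have hnear : e.source ∩ e ⁻¹' V ∈ 𝓝 x := (e.isOpen_inter_preimage hV).mem_nhds ⟨hx, hxV⟩
    filter_upwards [hnear] with z hz using (hS.fund_eq hz.1 hz.2 a b c).2
  have h1 := hasMFDerivAt_comp_coord he hx (i := .inl a) (hd.const_mul ((-1 : ℝ) ^ (b + c : ℕ)))
  rw [deriv_const_mul _ hd] at h1
  rw [heq.mfderiv_eq]
  have h2 : (((-1 : ℝ) ^ (b + c : ℕ) * deriv (fun t => S a b t / S a c t) (e x (.inl a))) •
      dq e (.inl a) x : Cot k r Q x) = 0 ↔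
      deriv (fun t => S a b t / S a c t) (e x (.inl a)) = 0 := by
    rw [smul_eq_zero, or_iff_left (dq_ne_zero he hx _), mul_eq_zero,
      or_iff_right (pow_ne_zero _ (by norm_num))]
  refine Iff.trans ?_ h2
  exact Eq.congr_left h1

theorem exists_nhds_levelSets (hP : IsAdapted G D 𝒦 ξ m₀ e) (hG : IsMetric G)
    (hA : IsSeparableKillingAlgebra G D 𝒦 ξ m₀)
    (hK : (K (Fin.last k) : Tensor2 k r Q) = G)
    (hΛ : IsEigenvalueMatrix G (fun i => (K i : Tensor2 k r Q)) ξ Λ) (hx : x ∈ e.source)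
    {a b c : Fin (k + 1)} (hreg : IsRegularPoint (r := r) Λ a b c x) :
    ∃ W, IsOpen W ∧ x ∈ W ∧ W ⊆ e.source ∧ (∀ y ∈ W, IsRegularPoint (r := r) Λ a b c y) ∧
      ∀ y ∈ W, ∀ z ∈ W, fund Λ a b c y = fund Λ a b c z ↔ e y (.inl a) = e z (.inl a) := by
  obtain ⟨ε, hε, hball⟩ := Metric.isOpen_iff.1 e.open_target (e x) (e.map_source hx)
  set V := Metric.ball (e x) ε with hVdef
  have hVo : IsOpen V := Metric.isOpen_ball
  obtain ⟨N, -, S, θ, η, hS⟩ := exists_stackelForm hP hG hA hK hΛ hVo (convex_ball _ _) hball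
  have hiff := fun {y : Q} (hy : y ∈ e.source) (hyV : e y ∈ V) =>
    hS.isRegularPoint_iff hP.mem_atlas hVo hy hyV a b c
  have hxV : e x ∈ V := Metric.mem_ball_self hε
  obtain ⟨h1, h2⟩ := (hiff hx hxV).1 hreg
  set s : ℝ → ℝ := fun t => S a b t / S a c t with hs
  have hI := isOpen_image_eval hVo (.inl a)
  set J : Set ℝ := ((fun y : Coord k r => y (.inl a)) '' V) ∩ S a c ⁻¹' {0}ᶜ with hJ
  have hJo : IsOpen J := (hS.smooth_S a c).continuousOn.isOpen_inter_preimage hI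
    isOpen_compl_singleton
  have hsJ : ContDiffOn ℝ ∞ s J := ((hS.smooth_S a b).mono Set.inter_subset_left).div
    ((hS.smooth_S a c).mono Set.inter_subset_left) fun t ht => ht.2
  have hJ' : IsOpen (J ∩ deriv s ⁻¹' {0}ᶜ) :=
    ((contDiffOn_infty_iff_deriv_of_isOpen hJo).1 hsJ).2.continuousOn.isOpen_inter_preimage hJo
      isOpen_compl_singleton
  -- On this interval the ratio is defined and its derivative has no zero, so Rolle's theorem makes
  -- it injective.
  obtain ⟨δ, hδ, hδJ⟩ := Metric.isOpen_iff.1 hJ' (e x (.inl a)) ⟨⟨⟨_, hxV, rfl⟩, h1⟩, h2⟩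
  have hinj : ∀ t ∈ Metric.ball (e x (.inl a)) δ, ∀ u ∈ Metric.ball (e x (.inl a)) δ,
      t < u → s t ≠ s u := by
    intro t ht u hu htu hst
    have hsub : Set.Icc t u ⊆ Metric.ball (e x (.inl a)) δ :=
      (convex_ball _ _).ordConnected.out ht hu
    obtain ⟨w, hw, hw'⟩ := exists_deriv_eq_zero htu
      (hsJ.continuousOn.mono fun v hv => (hδJ (hsub hv)).1) hst
    exact (hδJ (hsub (Set.Ioo_subset_Icc_self hw))).2 hw'
  refine ⟨e.source ∩ e ⁻¹' (V ∩ {y | y (.inl a) ∈ Metric.ball (e x (.inl a)) δ}),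
    e.isOpen_inter_preimage (hVo.inter (Metric.isOpen_ball.preimage (continuous_apply (Sum.inl a)))),
    ⟨hx, hxV, Metric.mem_ball_self hδ⟩, Set.inter_subset_left, ?_, ?_⟩
  · rintro y ⟨hy, hyV, hyδ⟩
    exact (hiff hy hyV).2 ⟨(hδJ hyδ).1.2, (hδJ hyδ).2⟩
  · rintro y ⟨hy, hyV, hyδ⟩ z ⟨hz, hzV, hzδ⟩
    rw [(hS.fund_eq hy hyV a b c).2, (hS.fund_eq hz hzV a b c).2]
    constructor
    · intro h
      have h3 : s (e y (.inl a)) = s (e z (.inl a)) :=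
        mul_left_cancel₀ (pow_ne_zero _ (by norm_num)) h
      rcases lt_trichotomy (e y (.inl a)) (e z (.inl a)) with h4 | h4 | h4
      · exact absurd h3 (hinj _ hyδ _ hzδ h4)
      · exact h4
      · exact absurd h3.symm (hinj _ hzδ _ hyδ h4)
    · intro h
      rw [h]

theorem symmetry_of_no_regular_point (hP : IsAdapted G D 𝒦 ξ m₀ e) (hG : IsMetric G)
    (hA : IsSeparableKillingAlgebra G D 𝒦 ξ m₀)
    (hK : (K (Fin.last k) : Tensor2 k r Q) = G)
    (hΛ : IsEigenvalueMatrix G (fun i => (K i : Tensor2 k r Q)) ξ Λ)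
    (h : ∀ b c, ∀ x ∈ e.source, ¬ IsRegularPoint (r := r) Λ a b c x) :
    SymmetryAfterRescaling G (fun i => (K i : Tensor2 k r Q)) e a := by
  intro V hVe hVo hVc
  obtain ⟨N, H, S, θ, η, hS⟩ := exists_stackelForm hP hG hA hK hΛ hVo hVc hVe
  obtain ⟨n, v, hn, hn0, hrow⟩ := exists_eq_mul_of_deriv_div_eq_zero
    (isOpen_image_eval hVo (.inl a)) (convex_image_eval hVc (.inl a)) (S := S a) (hS.smooth_S a)
    (by
      rintro _ ⟨y, hy, rfl⟩
      -- A zero row would make the Stäckel matrix singular.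
      by_contra! h0
      exact hS.regular y hy (Matrix.det_eq_zero_of_row_eq_zero a h0))
    (by
      rintro b c _ ⟨y, hy, rfl⟩ hc
      by_contra hd
      have hx := e.map_target (hVe hy)
      have hey := e.right_inv (hVe hy)
      refine h b c _ hx ((hS.isRegularPoint_iff hP.mem_atlas hVo hx (by rwa [hey]) a b c).2 ?_)
      rw [hey]
      exact ⟨hc, hd⟩)
  exact exists_standard_of_row_eq hP.isCompatibleChart hA H hS hn hn0 hrow

end Main

end KillingSep

end

theorem theorem4p11 {k r m₀ : ℕ} {Q : Type*} [TopologicalSpace Q]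
    [ChartedSpace (KillingSep.Coord k r) Q] [IsManifold (KillingSep.Mdl k r) ∞ Q]
    (G : KillingSep.Tensor2 k r Q) (hG : KillingSep.IsMetric G)
    (D : Submodule ℝ (KillingSep.VF k r Q)) (𝒦 : Submodule ℝ (KillingSep.Tensor2 k r Q))
    (ξ : Fin (k + 1) → KillingSep.OneForm k r Q)
    (hA : KillingSep.IsSeparableKillingAlgebra G D 𝒦 ξ m₀)
    (K : Module.Basis (Fin (k + 1)) ℝ 𝒦)
    (hK : (K (Fin.last k) : KillingSep.Tensor2 k r Q) = G)
    (Λ : Q → Matrix (Fin (k + 1)) (Fin (k + 1)) ℝ)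
    (hΛ : KillingSep.IsEigenvalueMatrix G (fun i => (K i : KillingSep.Tensor2 k r Q)) ξ Λ)
    (e : OpenPartialHomeomorph Q (KillingSep.Coord k r))
    (he : KillingSep.IsAdapted G D 𝒦 ξ m₀ e)
    (a : Fin (k + 1)) :
    Xor
      (KillingSep.SymmetryAfterRescaling G (fun i => (K i : KillingSep.Tensor2 k r Q)) e a)
      (KillingSep.LevelSetsDefineFoliation Λ e a) := by
  by_cases h : ∃ b c, ∃ x ∈ e.source, KillingSep.IsRegularPoint (r := r) Λ a b c x
  · obtain ⟨b, c, x, hx, hreg⟩ := h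
    refine Or.inr ⟨⟨b, c, ⟨x, hx, hreg⟩, fun y hy hy' =>
      KillingSep.exists_nhds_levelSets he hG hA hK hΛ hy hy'⟩, fun hsym => ?_⟩
    exact KillingSep.not_isRegularPoint_of_symmetry he.isCompatibleChart hG hK hΛ hsym hx b c hreg
  · push Not at h
    refine Or.inl ⟨KillingSep.symmetry_of_no_regular_point he hG hA hK hΛ h, ?_⟩
    rintro ⟨b, c, ⟨x, hx, hreg⟩, -⟩
    exact h b c x hx hreg
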